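/- Let $p$ be an odd prime, $m\ge 1$, $q=p^m$, let $\mathbb F_q$ be the finite field with $q$ elements, and let $g$ be a generator of $\mathbb F_q^*$. For $c\in\mathbb F_q^*$ let $\mathrm{ind}_g(c)$ be the integer $i$ with $0\le i\le q-2$ and $g^i=c$. Let $y\in\mathbb F_q^*$ be non-quartic, i.e. not a fourth power in $\mathbb F_q$, and for $n\ge 1$ let $$M_n(y)=\#\{(x_1,\dots,x_n)\in\mathbb F_q^n:\ x_1^4+\cdots+x_{n-1}^4+y\,x_n^4=0\}.$$ The identities below are identities of formal power series in $x$ over $\mathbb Q$. (i) Suppose $q\equiv 1\pmod 4$. Define integers $s,t$ as follows. If $p\equiv 1\pmod 4$, then $s,t$ are uniquely determined by $$q=s^2+4t^2,\quad \gcd(p,s)=1,\quad s\equiv 1\pmod 4,\quad 2t\equiv s\,g^{3(q-1)/4}\pmod p,$$ where the last congruence means equality in $\mathbb F_q$ of $2t\cdot 1$ and $s\,g^{3(q-1)/4}$. If $p\equiv 3\pmod 4$ (so that $m$ is even), then $s=(-p)^{m/2}$ and $t=0$. For $c\in\mathbb F_q^*$ put $$B_1(c,x)=\begin{cases} 3x-(6s+3)x^2+(-q+4s^2)x^3,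 & \mathrm{ind}_g(c)\equiv 0\pmod 4,\\ -x+(2s+8t-3)x^2+(-q-8st)x^3, & \mathrm{ind}_g(c)\equiv 1\pmod 4,\\ -x+(2s-3)x^2+(-q+16t^2)x^3, & \mathrm{ind}_g(c)\equiv 2\pmod 4,\\ -x+(2s-8t-3)x^2+(-q+8st)x^3, & \mathrm{ind}_g(c)\equiv 3\pmod 4, \end{cases}$$ $$B_2(c,x)=\begin{cases} 3x+(2s+1)x^2+(3q-4s^2)x^3, & \mathrm{ind}_g(c)\equiv 0\pmod 4,\\ -x+(2s-8t+1)x^2+(3q+8st)x^3, & \mathrm{ind}_g(c)\equiv 1\pmod 4,\\ -x+(-6s+1)x^2+(-5q-16t^2)x^3, & \mathrm{ind}_g(c)\equiv 2\pmod 4,\\ -x+(2s+8t+1)x^2+(3q-8st)x^3, & \mathrm{ind}_g(c)\equiv 3\pmod 4. \end{cases}$$ Then $$\sum_{n=1}^{\infty}M_{n+1}(y)x^n=\begin{cases} \dfrac{qx}{1-qx}+\dfrac{(q-1)\bigl(3x^2+B_1(y,x)\bigr)}{1-6qx^2+8qsx^3+(q^2-4qs^2)x^4}, & q\equiv 1\pmod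 8,\\[3mm] \dfrac{qx}{1-qx}+\dfrac{(q-1)\bigl(-x^2+B_2(-y,x)\bigr)}{1+2qx^2+8qsx^3+(9q^2-4qs^2)x^4}, & q\equiv 5\pmod 8. \end{cases}$$ (ii) If $q\equiv 3\pmod 4$, then $$\sum_{n=1}^{\infty}M_{n+1}(y)x^n=\frac{qx}{1-qx}+\frac{(q-1)x}{1+qx^2}.$$ -/

import Mathlib

namespace QuarticForm

open PowerSeries

/-- The number of zeros in `Fⁿ` of `x₁⁴ + ⋯ + xₙ₋₁⁴ + y xₙ⁴`
(the last variable, of index `n - 1` in `Fin n`, carries the coefficient `y`). -/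
noncomputable def numZeros (F : Type*) [Field F] (n : ℕ) (y : F) : ℕ :=
  Nat.card {x : Fin n → F // ∑ i : Fin n, (if (i : ℕ) + 1 = n then y else 1) * x i ^ 4 = 0}

/-- The generating function `∑_{n ≥ 1} M_{n+1}(y) xⁿ`, as a formal power series over `ℚ`. -/
noncomputable def genFun (F : Type*) [Field F] (y : F) : PowerSeries ℚ :=
  PowerSeries.mk fun n => if n = 0 then 0 else (numZeros F (n + 1) y : ℚ)

/-- The index (discrete logarithm) of `c` with respect to `g`: the least `i ≥ 0` with `g ^ i = c`. -/
noncomputable def ind {F : Type*} [Field F] (g c : Fˣ) : ℕ :=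
  sInf {i : ℕ | g ^ i = c}

/-- The conditions that determine the integers `s` and `t` for the field `F` with `q = p ^ m`
elements and the generator `g` of `Fˣ`, when `q ≡ 1 (mod 4)`.
The congruence `2t ≡ s g^{3(q-1)/4} (mod p)` is an equation in `F`, because
integers that are congruent modulo `p` are those with the same image in `F`. -/
def IsParam {F : Type*} [Field F] (p m q : ℕ) (g : Fˣ) (s t : ℤ) : Prop :=
  (p % 4 = 1 →
    (q : ℤ) = s ^ 2 + 4 * t ^ 2 ∧ Int.gcd (p : ℤ) s = 1 ∧ s ≡ 1 [ZMOD 4] ∧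
      2 * (t : F) = (s : F) * (g : F) ^ (3 * (q - 1) / 4)) ∧
  (p % 4 = 3 → s = (-(p : ℤ)) ^ (m / 2) ∧ t = 0)

/-- The polynomial `B₁(c, x)`, where `i` is the index of `c`. -/
noncomputable def B₁ (q s t : ℤ) (i : ℕ) : PowerSeries ℚ :=
  if i % 4 = 0 then
    3 * X - ((6 * s + 3 : ℤ) : ℚ⟦X⟧) * X ^ 2 + ((-q + 4 * s ^ 2 : ℤ) : ℚ⟦X⟧) * X ^ 3
  else if i % 4 = 1 then
    -X + ((2 * s + 8 * t - 3 : ℤ) : ℚ⟦X⟧) * X ^ 2 + ((-q - 8 * s * t : ℤ) : ℚ⟦X⟧) * X ^ 3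
  else if i % 4 = 2 then
    -X + ((2 * s - 3 : ℤ) : ℚ⟦X⟧) * X ^ 2 + ((-q + 16 * t ^ 2 : ℤ) : ℚ⟦X⟧) * X ^ 3
  else
    -X + ((2 * s - 8 * t - 3 : ℤ) : ℚ⟦X⟧) * X ^ 2 + ((-q + 8 * s * t : ℤ) : ℚ⟦X⟧) * X ^ 3

/-- The polynomial `B₂(c, x)`, where `i` is the index of `c`. -/
noncomputable def B₂ (q s t : ℤ) (i : ℕ) : PowerSeries ℚ :=
  if i % 4 = 0 then
    3 * X + ((2 * s + 1 : ℤ) : ℚ⟦X⟧) * X ^ 2 + ((3 * q - 4 * s ^ 2 : ℤ) : ℚ⟦X⟧) * X ^ 3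
  else if i % 4 = 1 then
    -X + ((2 * s - 8 * t + 1 : ℤ) : ℚ⟦X⟧) * X ^ 2 + ((3 * q + 8 * s * t : ℤ) : ℚ⟦X⟧) * X ^ 3
  else if i % 4 = 2 then
    -X + ((-6 * s + 1 : ℤ) : ℚ⟦X⟧) * X ^ 2 + ((-5 * q - 16 * t ^ 2 : ℤ) : ℚ⟦X⟧) * X ^ 3
  else
    -X + ((2 * s + 8 * t + 1 : ℤ) : ℚ⟦X⟧) * X ^ 2 + ((3 * q - 8 * s * t : ℤ) : ℚ⟦X⟧) * X ^ 3

end QuarticForm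

/-! Detecting zeros with a primitive additive character `ψ` gives q·M_{n+1}(y) = qⁿ⁺¹ + Σ_{a≠0}
S(a)ⁿ S(ay), where S(a) = Σₓ ψ(a x⁴) (`card_mul_numZeros`). The series is therefore rational once
the values of S are known.

If q = 4k+1, let χ be the quartic character with χ(g) = i. Then S(a) depends only on χ(a), and its
four values are B ± U and −B ± V, built from the Gauss sums of χ, χ², χ³. Each class has k elements,
so the second term is a sum of four geometric series. Its common denominator and numerators are
polynomial identities in B, U, V (`period_quartic`, `period_numerator_I`,
`period_numerator_neg_one`), which need only B², U², V² and UV. These come from G(χ)² = G(χ²)J(χ,χ),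
its conjugate form and G(χ)G(χ³) = χ(−1)q, with J(χ,χ) = −s + 2ti.

It remains to identify s and t. The norm of J(χ,χ) is q, and a divisibility by 2(i−1) in ℤ[i] fixes
s modulo 4. For p ≡ 1 (mod 4), the map ℤ[i] → F with i ↦ gᵏ turns J(χ,χ) into a vanishing power sum,
which is the congruence for t; the map i ↦ g³ᵏ gives a binomial coefficient prime to p, whence p ∤
s. For p ≡ 3 (mod 4), a descent on sums of two squares forces t = 0.

If q ≡ 3 (mod 4), fourth powers of units are exactly the nonzero squares, so S(a) = ρ(a)G with ρ
quadratic and G² = −q. -/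

namespace QuarticForm

open PowerSeries

/-! ### Zero counts through exponential sums -/

section Counting

lemma addChar_map_sum {A M ι : Type*} [AddCommMonoid A] [CommMonoid M] (ψ : AddChar A M)
    (s : Finset ι) (f : ι → A) : ψ (∑ i ∈ s, f i) = ∏ i ∈ s, ψ (f i) :=
  map_prod ψ.toMonoidHom (fun i => Multiplicative.ofAdd (f i)) s

variable {F : Type*} [Field F]

/-- The quartic exponential sum `∑ₓ ψ(a x⁴)`. -/
noncomputable def quarticSum [Fintype F] (ψ : AddChar F ℂ) (a : F) : ℂ := ∑ x : F, ψ (a * x ^ 4)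

/-- Orthogonality of additive characters: the sum over the variables factors for each `a`, and `a =
0` contributes the main term. -/
lemma card_mul_numZeros [Fintype F] [DecidableEq F] {ψ : AddChar F ℂ} (hψ : ψ.IsPrimitive) (n : ℕ) (y : F) :
    (Fintype.card F : ℂ) * numZeros F (n + 1) y =
      (Fintype.card F : ℂ) ^ (n + 1) +
        ∑ a : Fˣ, quarticSum ψ a ^ n * quarticSum ψ (a * y) := by
  have h1 : ∀ a : F, ∑ x : Fin (n + 1) → F,
      ψ (a * ∑ i : Fin (n + 1), (if (i : ℕ) + 1 = n + 1 then y else 1) * x i ^ 4) =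
      quarticSum ψ a ^ n * quarticSum ψ (a * y) := by
    intro a
    have : ∀ x : Fin (n + 1) → F,
        ψ (a * ∑ i : Fin (n + 1), (if (i : ℕ) + 1 = n + 1 then y else 1) * x i ^ 4) =
        ∏ i : Fin (n + 1), ψ (a * ((if (i : ℕ) + 1 = n + 1 then y else 1) * x i ^ 4)) := by
      intro x
      rw [Finset.mul_sum, addChar_map_sum]
    simp_rw [this]
    rw [← Fintype.prod_sum (fun (i : Fin (n + 1)) (z : F) =>
      ψ (a * ((if (i : ℕ) + 1 = n + 1 then y else 1) * z ^ 4))), Fin.prod_univ_castSucc]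
    congr 1
    · rw [Finset.prod_congr rfl (g := fun _ => quarticSum ψ a), Finset.prod_const,
        Finset.card_univ, Fintype.card_fin]
      intro i _
      have : (i.castSucc : ℕ) + 1 ≠ n + 1 := by
        have := i.2
        simp only [Fin.val_castSucc]
        lia
      simp [quarticSum, i.2.ne]
    · simp [quarticSum, mul_assoc]
  have h2 : (Fintype.card F : ℂ) * numZeros F (n + 1) y = ∑ a : F,
      quarticSum ψ a ^ n * quarticSum ψ (a * y) := by
    simp_rw [← h1]
    rw [Finset.sum_comm]
    simp_rw [AddChar.sum_mulShift _ hψ]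
    rw [numZeros, Nat.card_eq_fintype_card, Fintype.card_subtype, Finset.card_eq_sum_ones,
      Finset.sum_filter]
    push_cast
    rw [Finset.mul_sum]
    refine Finset.sum_congr rfl fun x _ => ?_
    split_ifs <;> simp
  rw [h2, Fintype.sum_eq_add_sum_subtype_ne _ (0 : F)]
  congr 1
  · simp [quarticSum, pow_succ]
  · exact (Fintype.sum_equiv unitsEquivNeZero _ _ fun a => rfl).symm

lemma numZeros_one [Finite F] {y : F} (hy : y ≠ 0) : numZeros F 1 y = 1 := by
  rw [numZeros, Nat.card_eq_one_iff_unique]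
  refine ⟨⟨fun a b => Subtype.ext (funext fun i => ?_)⟩, ⟨⟨0, by simp⟩⟩⟩
  have ha := a.2
  have hb := b.2
  rw [Subsingleton.elim i 0]
  simp only [Finset.univ_unique, Fin.default_eq_zero, Fin.isValue, Fin.val_eq_zero, zero_add,
    ite_true, Finset.sum_singleton, mul_eq_zero, hy, false_or, pow_eq_zero_iff, ne_eq,
    OfNat.ofNat_ne_zero, not_false_eq_true] at ha hb
  rw [ha, hb]

lemma mk_pow_mul_one_sub {R : Type*} [CommRing R] (c : R) :
    (PowerSeries.mk fun n => c ^ n) * (1 - C c * X) = 1 := by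
  ext n
  cases n with
  | zero => simp
  | succ n =>
    rw [mul_sub, mul_one, ← mul_assoc, map_sub, PowerSeries.coeff_succ_mul_X, mul_comm,
      PowerSeries.coeff_C_mul]
    simp [PowerSeries.coeff_one, pow_succ']

/-- Reduces the theorem to a denominator-free identity over ℂ, which descends to ℚ because
coefficientwise extension of scalars is injective. The factor `q` on the right is the one produced
by orthogonality. -/
lemma genFun_eq_of_mul_eq [Fintype F] [DecidableEq F] {ψ : AddChar F ℂ} (hψ : ψ.IsPrimitive) {y : F} (hy : y ≠ 0)
    {q : ℕ} (hq : Fintype.card F = q) {N D : ℚ⟦X⟧} (hD : constantCoeff D = 1)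
    (h : (PowerSeries.mk fun n => ∑ a : Fˣ, quarticSum ψ a ^ n * quarticSum ψ (a * y)) *
      PowerSeries.map (algebraMap ℚ ℂ) D =
        (q : ℂ⟦X⟧) * ((q : ℂ⟦X⟧) - 1) * PowerSeries.map (algebraMap ℚ ℂ) N) :
    genFun F y = (q : ℚ⟦X⟧) * X * (1 - (q : ℚ⟦X⟧) * X)⁻¹ + ((q : ℚ⟦X⟧) - 1) * N * D⁻¹ := by
  have hq0 : (q : ℂ) ≠ 0 := by
    rw [← hq]; exact_mod_cast Fintype.card_ne_zero
  have hqX : (q : ℂ⟦X⟧) ≠ 0 := by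
    intro h0
    apply hq0
    simpa using congrArg (constantCoeff (R := ℂ)) h0
  set E : ℚ⟦X⟧ := 1 - (q : ℚ⟦X⟧) * X with hE
  have hE1 : constantCoeff E = 1 := by simp [hE]
  have hDi : D * D⁻¹ = 1 := PowerSeries.mul_inv_cancel _ (by simp [hD])
  have hEi : E * E⁻¹ = 1 := PowerSeries.mul_inv_cancel _ (by simp [hE1])
  have key : (q : ℂ⟦X⟧) * PowerSeries.map (algebraMap ℚ ℂ) (genFun F y) =
      (q : ℂ⟦X⟧) * (PowerSeries.mk (fun n => (q : ℂ) ^ n) - 1) +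
      (PowerSeries.mk fun n => ∑ a : Fˣ, quarticSum ψ a ^ n * quarticSum ψ (a * y)) := by
    ext n
    have hc := card_mul_numZeros hψ n y
    rw [hq] at hc
    have : (q : ℂ⟦X⟧) = C (q : ℂ) := by simp
    rw [map_add, this, PowerSeries.coeff_C_mul, PowerSeries.coeff_C_mul, PowerSeries.coeff_map,
      genFun, map_sub, PowerSeries.coeff_mk, PowerSeries.coeff_mk, PowerSeries.coeff_mk,
      PowerSeries.coeff_one]
    -- The constant term of `genFun` is 0 by convention. Since M₁ = 1, the exponential sums at n = 0
    -- add up to 0, and the `- 1` in `key` removes the constant term of the geometric series.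
    split_ifs with hn
    · subst hn
      rw [zero_add, numZeros_one hy] at hc
      simp at hc ⊢
      linear_combination -hc
    · simp only [map_natCast]
      linear_combination hc
  have key2 : E * D * genFun F y = (q : ℚ⟦X⟧) * X * D + ((q : ℚ⟦X⟧) - 1) * N * E := by
    apply PowerSeries.map_injective (algebraMap ℚ ℂ) (algebraMap ℚ ℂ).injective
    apply mul_left_cancel₀ hqX
    have hg := mk_pow_mul_one_sub (q : ℂ)
    simp only [map_natCast] at hg
    simp only [hE, map_mul, map_add, map_sub, map_natCast, map_one, PowerSeries.map_X]
    set M := PowerSeries.map (algebraMap ℚ ℂ)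
    linear_combination (1 - (q : ℂ⟦X⟧) * X) * M D * key + (1 - (q : ℂ⟦X⟧) * X) * h +
      (q : ℂ⟦X⟧) * M D * hg
  linear_combination (E⁻¹ * D⁻¹) * key2 - (genFun F y) * (D * D⁻¹) * hEi - genFun F y * hDi
    + (q : ℚ⟦X⟧) * X * E⁻¹ * hDi + ((q : ℚ⟦X⟧) - 1) * N * D⁻¹ * hEi

end Counting

/-! ### Sums over fourth powers -/

section FourthPowers

variable {F : Type*} [Field F] [Fintype F] [DecidableEq F]

lemma card_filter_pow_four_eq (v : Fˣ) :
    Finset.card {u : Fˣ | u ^ 4 = v} =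
      if ∃ z : Fˣ, z ^ 4 = v then Finset.card {u : Fˣ | u ^ 4 = 1} else 0 := by
  split_ifs with h
  · exact MonoidHom.card_fiber_eq_of_mem_range (powMonoidHom 4 : Fˣ →* Fˣ) h ⟨1, by simp⟩
  · push Not at h
    simp [h]

/-- A sum over fourth powers, written with a function `N` that counts the fourth roots. -/
lemma sum_pow_four {N : F → ℂ} (h0 : N 0 = 1)
    (hN : ∀ v : Fˣ, N v = Finset.card {u : Fˣ | u ^ 4 = v}) (f : F → ℂ) :
    ∑ x : F, f (x ^ 4) = ∑ b : F, f b * N b := by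
  rw [Fintype.sum_eq_add_sum_subtype_ne _ (0 : F), Fintype.sum_eq_add_sum_subtype_ne _ (0 : F)]
  congr 1
  · simp [h0]
  · rw [← Fintype.sum_equiv unitsEquivNeZero (fun u : Fˣ => f ((u : F) ^ 4)) _ fun a => rfl,
      ← Fintype.sum_equiv unitsEquivNeZero (fun u : Fˣ => f u * N u) _ fun a => rfl,
      ← Finset.sum_fiberwise Finset.univ (fun u : Fˣ => u ^ 4)]
    refine Finset.sum_congr rfl fun v _ => ?_
    rw [hN, Finset.sum_congr rfl (g := fun _ => f v), Finset.sum_const, nsmul_eq_mul, mul_comm]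
    intro u hu
    rw [Finset.mem_filter] at hu
    rw [← hu.2]
    simp

end FourthPowers

/-! ### The quartic character and its exponential sum, q ≡ 1 (mod 4) -/

section QuarticCharacter

variable {F : Type*} [Field F] {g : Fˣ} (hg : ∀ u : Fˣ, u ∈ Subgroup.zpowers g)
  {χ : MulChar F ℂ} (hχ : χ g = Complex.I)

lemma I_pow_cases (n : ℕ) : (n % 4 = 0 ∧ Complex.I ^ n = 1) ∨ (n % 4 = 1 ∧ Complex.I ^ n = Complex.I)
    ∨ (n % 4 = 2 ∧ Complex.I ^ n = -1) ∨ (n % 4 = 3 ∧ Complex.I ^ n = -Complex.I) := by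
  have h := Nat.div_add_mod n 4
  have h4 : Complex.I ^ n = Complex.I ^ (n % 4) := by
    conv_lhs => rw [← h, pow_add, pow_mul, Complex.I_pow_four, one_pow, one_mul]
  have : n % 4 < 4 := Nat.mod_lt _ (by norm_num)
  rw [h4]
  interval_cases n % 4 <;> simp [Complex.I_pow_three]

include hχ in
lemma char_pow_generator (n : ℕ) : χ ((g ^ n : Fˣ) : F) = Complex.I ^ n := by
  rw [Units.val_pow_eq_pow_val, map_pow, hχ]

include hχ in
lemma quarticChar_sq_ne_one : χ ^ 2 ≠ 1 := by
  intro h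
  have := congrArg (fun φ : MulChar F ℂ => φ g) h
  simp only [MulChar.pow_apply_coe, hχ, Complex.I_sq, MulChar.one_apply_coe] at this
  norm_num at this

include hχ in
lemma quarticChar_ne_one : χ ≠ 1 := fun h => quarticChar_sq_ne_one hχ (by simp [h])

variable [Fintype F]

include hg in
lemma exists_pow_generator (u : Fˣ) : ∃ n : ℕ, g ^ n = u :=
  (mem_powers_iff_mem_zpowers.2 (hg u))

include hg in
lemma pow_ind (u : Fˣ) : g ^ ind g u = u :=
  Nat.sInf_mem (s := {i : ℕ | g ^ i = u}) (exists_pow_generator hg u)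

include hg hχ in
lemma char_unit_cases (u : Fˣ) : χ u = 1 ∨ χ u = Complex.I ∨ χ u = -1 ∨ χ u = -Complex.I := by
  obtain ⟨n, rfl⟩ := exists_pow_generator hg u
  rw [char_pow_generator hχ]
  rcases I_pow_cases n with h | h | h | h <;> simp [h.2]

include hg hχ in
lemma char_eq_one_iff (u : Fˣ) : χ u = 1 ↔ ∃ z : Fˣ, z ^ 4 = u := by
  constructor
  · intro h
    obtain ⟨n, rfl⟩ := exists_pow_generator hg u
    rw [char_pow_generator hχ] at h
    have h4 : n % 4 = 0 := by
      rcases I_pow_cases n with h' | h' | h' | h'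
      · exact h'.1
      all_goals
        have := h.symm.trans h'.2
        simp [Complex.ext_iff] at this
        try norm_num at this
    refine ⟨g ^ (n / 4), ?_⟩
    rw [← pow_mul]
    congr 1
    lia
  · rintro ⟨z, rfl⟩
    rw [Units.val_pow_eq_pow_val, map_pow]
    rcases char_unit_cases hg hχ z with h | h | h | h <;> rw [h] <;> norm_num [Complex.I_pow_four]

include hg hχ in
lemma char_pow_four (u : Fˣ) : χ u ^ 4 = 1 := by
  rw [← map_pow, ← Units.val_pow_eq_pow_val, char_eq_one_iff hg hχ]
  exact ⟨u, rfl⟩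

include hg hχ in
lemma quarticChar_pow_four : χ ^ 4 = 1 := by
  ext u
  rw [MulChar.pow_apply_coe, char_pow_four hg hχ, MulChar.one_apply_coe]

include hg hχ in
lemma quarticChar_inv : χ⁻¹ = χ ^ 3 :=
  inv_eq_of_mul_eq_one_right (by rw [← quarticChar_pow_four hg hχ, ← pow_succ'])

lemma gaussSum_mul_gaussSum_inv {φ : MulChar F ℂ} (hφ : φ ≠ 1) {ψ : AddChar F ℂ}
    (hψ : ψ.IsPrimitive) :
    gaussSum φ ψ * gaussSum φ⁻¹ ψ = φ⁻¹ (-1) * Fintype.card F := by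
  rw [← gaussSum_mul_gaussSum_eq_card hφ hψ, ← mul_gaussSum_inv_eq_gaussSum φ⁻¹ ψ]
  ring

include hg hχ in
lemma ind_cases (u : Fˣ) : (ind g u % 4 = 0 ∧ χ u = 1) ∨ (ind g u % 4 = 1 ∧ χ u = Complex.I) ∨
    (ind g u % 4 = 2 ∧ χ u = -1) ∨ (ind g u % 4 = 3 ∧ χ u = -Complex.I) := by
  have := char_pow_generator hχ (ind g u)
  rw [pow_ind hg] at this
  rw [this]
  exact I_pow_cases _

variable [DecidableEq F] {k : ℕ} (hk : Fintype.card F = 4 * k + 1)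

include hg in
lemma orderOf_generator {n : ℕ} (hn : Fintype.card F = n + 1) : orderOf g = n := by
  rw [orderOf_eq_card_of_forall_mem_zpowers hg, Nat.card_eq_fintype_card, Fintype.card_units, hn]
  rfl

include hg hk in
lemma card_pow_four_eq_one : Finset.card {u : Fˣ | u ^ 4 = 1} = 4 := by
  have hk0 : 0 < 4 * k := by
    have := Fintype.one_lt_card (α := F)
    lia
  have hp : IsPrimitiveRoot (g ^ k) 4 := by
    have := IsPrimitiveRoot.orderOf g
    rw [orderOf_generator hg hk] at this
    exact this.pow hk0 (mul_comm 4 k)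
  have hp' : IsPrimitiveRoot ((g ^ k : Fˣ) : F) 4 := hp.map_of_injective
    (f := Units.coeHom F) Units.val_injective
  have := hp'.card_rootsOfUnity
  refine (Nat.subtype_card (p := fun u : Fˣ => u ∈ rootsOfUnity 4 F) _ fun u => ?_).symm.trans this
  simp [mem_rootsOfUnity]

include hg hk hχ in
-- Orthogonality for the group {1, χ, χ², χ³}: the sum is 4 when χ(v) = 1, and otherwise vanishes
-- because χ(v)⁴ = 1.
lemma char_count (v : Fˣ) :
    1 + χ v + χ v ^ 2 + χ v ^ 3 = (Finset.card {u : Fˣ | u ^ 4 = v} : ℂ) := by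
  rw [card_filter_pow_four_eq, card_pow_four_eq_one hg hk]
  split_ifs with h
  · rw [(char_eq_one_iff hg hχ v).2 h]; norm_num
  · rw [← char_eq_one_iff hg hχ v] at h
    have h4 := char_pow_four hg hχ v
    have : (χ v - 1) * (1 + χ v + χ v ^ 2 + χ v ^ 3) = 0 := by linear_combination h4
    simpa [sub_eq_zero, h] using this

include hg hk hχ in
lemma quarticSum_eq {ψ : AddChar F ℂ} (hψ : ψ.IsPrimitive) (a : Fˣ) :
    quarticSum ψ a = χ a ^ 3 * gaussSum χ ψ + χ a ^ 2 * gaussSum (χ ^ 2) ψ +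
      χ a * gaussSum (χ ^ 3) ψ := by
  have h4 := char_pow_four hg hχ a
  have hs : quarticSum ψ a =
      gaussSum χ (ψ.mulShift a) + gaussSum (χ ^ 2) (ψ.mulShift a) +
        gaussSum (χ ^ 3) (ψ.mulShift a) := by
    have h0 : ∑ b : F, ψ.mulShift a b = 0 := by
      have := AddChar.sum_mulShift (a : F) hψ
      simpa [mul_comm, AddChar.mulShift_apply] using this
    have h00 : 1 + χ 0 + χ 0 ^ 2 + χ 0 ^ 3 = 1 := by simp [MulChar.map_zero]
    rw [quarticSum, sum_pow_four (N := fun b => 1 + χ b + χ b ^ 2 + χ b ^ 3) h00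
      (fun v => char_count hg hχ hk v) (fun b => ψ (a * b))]
    simp only [gaussSum, ← Finset.sum_add_distrib]
    refine Eq.trans ?_ ((congrArg (· + _) h0).trans (zero_add _))
    rw [← Finset.sum_add_distrib]
    refine Finset.sum_congr rfl fun b _ => ?_
    rw [MulChar.pow_apply' _ two_ne_zero, MulChar.pow_apply' _ three_ne_zero,
      AddChar.mulShift_apply]
    ring
  have e1 := gaussSum_mulShift χ ψ a
  have e2 := gaussSum_mulShift (χ ^ 2) ψ a
  have e3 := gaussSum_mulShift (χ ^ 3) ψ a
  rw [MulChar.pow_apply_coe] at e2 e3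
  rw [hs, ← e1, ← e2, ← e3]
  linear_combination (-gaussSum χ (ψ.mulShift a) - gaussSum (χ ^ 2) (ψ.mulShift a) -
    gaussSum (χ ^ 3) (ψ.mulShift a)) * h4

include hg hk hχ in
-- Translating by g, g², g³ multiplies χ by i, −1, −i. Averaging the four translates makes every
-- summand the full sum over the fourth roots of unity.
lemma sum_char (f : ℂ → ℂ) : ∑ a : Fˣ, f (χ a) =
    k * (f 1 + f Complex.I + f (-1) + f (-Complex.I)) := by
  have hshift : ∀ c : Fˣ, ∑ a : Fˣ, f (χ a) = ∑ a : Fˣ, f (χ c * χ a) := fun c => by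
    rw [← Equiv.sum_comp (Equiv.mulLeft c)]
    simp
  have h1 := hshift g
  have h2 := hshift (g ^ 2)
  have h3 := hshift (g ^ 3)
  rw [char_pow_generator hχ] at h2 h3
  rw [hχ] at h1
  have h4 : 4 * ∑ a : Fˣ, f (χ a) = ∑ a : Fˣ, (f 1 + f Complex.I + f (-1) + f (-Complex.I)) := by
    rw [show 4 * ∑ a : Fˣ, f (χ a) = ∑ a : Fˣ, f (χ a) + ∑ a : Fˣ, f (Complex.I * χ a) +
      ∑ a : Fˣ, f (Complex.I ^ 2 * χ a) + ∑ a : Fˣ, f (Complex.I ^ 3 * χ a) by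
        rw [← h1, ← h2, ← h3]; ring]
    simp only [← Finset.sum_add_distrib]
    refine Finset.sum_congr rfl fun a _ => ?_
    rcases char_unit_cases hg hχ a with h | h | h | h <;> rw [h] <;>
      simp only [Complex.I_sq, Complex.I_pow_three, mul_one, mul_neg, neg_mul, one_mul, neg_neg,
        Complex.I_mul_I] <;> ring
  rw [Finset.sum_const, Finset.card_univ, Fintype.card_units, hk, nsmul_eq_mul] at h4
  push_cast [Nat.add_sub_cancel] at h4
  linear_combination h4 / 4

include hg hk in
lemma generator_pow_two_mul : g ^ (2 * k) = -1 := by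
  have hk0 : 0 < k := by
    have := Fintype.one_lt_card (α := F)
    lia
  have ho := orderOf_generator hg hk
  have h1 : (g ^ (2 * k)) ^ 2 = 1 := by
    rw [← pow_mul, ← orderOf_dvd_iff_pow_eq_one, ho]
    exact ⟨1, by ring⟩
  have h2 : g ^ (2 * k) ≠ 1 := fun h => by
    rw [← orderOf_dvd_iff_pow_eq_one, ho] at h
    have := Nat.le_of_dvd (by lia) h
    lia
  have h3 : ((g ^ (2 * k) : Fˣ) : F) ^ 2 = 1 := by
    rw [← Units.val_pow_eq_pow_val, h1, Units.val_one]
  rcases sq_eq_one_iff.1 h3 with h | h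
  · exact absurd (Units.ext h) h2
  · exact Units.ext h

include hg hχ hk in
lemma char_neg_one : χ (-1) = (-1) ^ k := by
  have := char_pow_generator hχ (2 * k)
  rw [generator_pow_two_mul hg hk, pow_mul, Complex.I_sq] at this
  simpa using this

end QuarticCharacter

/-! ### Polynomial identities for the four values B ± U, −B ± V -/

section PeriodIdentities

variable {R : Type*} [CommRing R] {X B U V s t q ε : R}
  (hB : B ^ 2 = q) (hU : U ^ 2 = -2 * s * B + 2 * ε * q) (hV : V ^ 2 = 2 * s * B + 2 * ε * q)
  (hUV : U * V = 4 * t * B)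

include hB hU in
lemma period_quadratic_one : (1 - (B + U) * X) * (1 - (B - U) * X) =
    1 - 2 * B * X + ((1 - 2 * ε) * q + 2 * s * B) * X ^ 2 := by
  linear_combination X ^ 2 * (hB - hU)

include hB hV in
lemma period_quadratic_I : (1 - (-B + V) * X) * (1 - (-B - V) * X) =
    1 + 2 * B * X + ((1 - 2 * ε) * q - 2 * s * B) * X ^ 2 := by
  linear_combination X ^ 2 * (hB - hV)

include hB hU hV in
lemma period_quartic : ((1 - (B + U) * X) * (1 - (B - U) * X)) *
    ((1 - (-B + V) * X) * (1 - (-B - V) * X)) =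
    1 + (2 * (1 - 2 * ε) - 4) * q * X ^ 2 + 8 * q * s * X ^ 3 +
      ((1 - 2 * ε) ^ 2 * q ^ 2 - 4 * q * s ^ 2) * X ^ 4 := by
  rw [period_quadratic_one hB hU, period_quadratic_I hB hV]
  linear_combination (-4 * X ^ 2 + 8 * s * X ^ 3 - 4 * s ^ 2 * X ^ 4) * hB

include hB hU hV hUV in
-- Numerator of Σ_c τ(ic)/(1 − τ(c)X), c running over the fourth roots of unity. Opposite classes
-- are paired, so that U and V enter only through U², V² and UV.
lemma period_numerator_I :
    ((-B + V) * (1 - (B - U) * X) + (-B - V) * (1 - (B + U) * X)) *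
        ((1 - (-B + V) * X) * (1 - (-B - V) * X)) +
      ((B - U) * (1 - (-B - V) * X) + (B + U) * (1 - (-B + V) * X)) *
        ((1 - (B + U) * X) * (1 - (B - U) * X)) =
    4 * q * (-X + (2 * s + 8 * t) * X ^ 2 + ((1 - 2 * ε) * q - 8 * s * t) * X ^ 3) := by
  rw [period_quadratic_one hB hU, period_quadratic_I hB hV,
    show (-B + V) * (1 - (B - U) * X) + (-B - V) * (1 - (B + U) * X) =
      -2 * B + 2 * (q + 4 * t * B) * X by linear_combination 2 * X * (hB + hUV),
    show (B - U) * (1 - (-B - V) * X) + (B + U) * (1 - (-B + V) * X) =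
      2 * B + 2 * (q - 4 * t * B) * X by linear_combination 2 * X * (hB - hUV)]
  linear_combination (-8 * X + (8 * s + 32 * t) * X ^ 2 - 32 * s * t * X ^ 3) * hB

include hB hU hV in
lemma period_numerator_neg_one (hε : ε ^ 2 = 1) :
    ((B - U) * (1 - (B - U) * X) + (B + U) * (1 - (B + U) * X)) *
        ((1 - (-B + V) * X) * (1 - (-B - V) * X)) +
      ((-B - V) * (1 - (-B - V) * X) + (-B + V) * (1 - (-B + V) * X)) *
        ((1 - (B + U) * X) * (1 - (B - U) * X)) =
    4 * q * ((1 - 2 * ε) * X + 2 * s * X ^ 2 + (3 * q - 4 * s ^ 2) * X ^ 3) := by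
  rw [period_quadratic_one hB hU, period_quadratic_I hB hV,
    show (B - U) * (1 - (B - U) * X) + (B + U) * (1 - (B + U) * X) =
      2 * B - 2 * ((1 + 2 * ε) * q - 2 * s * B) * X by linear_combination -2 * X * (hB + hU),
    show (-B - V) * (1 - (-B - V) * X) + (-B + V) * (1 - (-B + V) * X) =
      -2 * B - 2 * ((1 + 2 * ε) * q + 2 * s * B) * X by linear_combination -2 * X * (hB + hV)]
  linear_combination (8 * X + 8 * s * X ^ 2 - 16 * s ^ 2 * X ^ 3) * hB + 16 * q ^ 2 * X ^ 3 * hε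

end PeriodIdentities

/-! ### From Gauss sum relations to the generating function -/

section GaussRelations

variable {F : Type*} [Field F] [Fintype F] [DecidableEq F] {g : Fˣ}
  (hg : ∀ u : Fˣ, u ∈ Subgroup.zpowers g) {χ : MulChar F ℂ} (hχ : χ g = Complex.I)
  {k : ℕ} (hk : Fintype.card F = 4 * k + 1) {ψ : AddChar F ℂ} (hψ : ψ.IsPrimitive)

include hg hχ hk hψ in
lemma gaussSum_mul_gaussSum_cube :
    gaussSum χ ψ * gaussSum (χ ^ 3) ψ = (-1) ^ k * (4 * k + 1 : ℕ) := by
  have := gaussSum_mul_gaussSum_inv (quarticChar_ne_one hχ) hψ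
  rwa [MulChar.inv_apply', inv_neg_one, quarticChar_inv hg hχ, char_neg_one hg hχ hk, hk] at this

include hg hχ hk hψ in
lemma gaussSum_sq_mul_self :
    gaussSum (χ ^ 2) ψ * gaussSum (χ ^ 2) ψ = (4 * k + 1 : ℕ) := by
  have := gaussSum_mul_gaussSum_inv (quarticChar_sq_ne_one hχ) hψ
  have e : (χ ^ 2)⁻¹ = χ ^ 2 :=
    inv_eq_of_mul_eq_one_right (by rw [← pow_add, quarticChar_pow_four hg hχ])
  rw [e, MulChar.pow_apply' _ two_ne_zero, char_neg_one hg hχ hk, ← pow_mul, mul_comm k,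
    pow_mul, hk] at this
  simpa using this

include hg hχ hk hψ in
/-- The quartic exponential sums in terms of Gauss sums: on the classes of `1`, `-1`, `i`, `-i`
they are `B + U`, `B - U`, `-B + V`, `-B - V`. -/
lemma exists_periods {s t : ℤ} (hJ : jacobiSum χ χ = -s + 2 * t * Complex.I)
    (hJ' : jacobiSum χ⁻¹ χ⁻¹ = -s - 2 * t * Complex.I) :
    ∃ (B U V : ℂ) (τ : ℂ → ℂ), (∀ a : Fˣ, quarticSum ψ a = τ (χ a)) ∧
      τ 1 = B + U ∧ τ (-1) = B - U ∧ τ Complex.I = -B + V ∧ τ (-Complex.I) = -B - V ∧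
      B ^ 2 = (4 * k + 1 : ℕ) ∧
      U ^ 2 = -2 * s * B + 2 * (-1) ^ k * (4 * k + 1 : ℕ) ∧
      V ^ 2 = 2 * s * B + 2 * (-1) ^ k * (4 * k + 1 : ℕ) ∧
      U * V = 4 * t * B := by
  have h4 := quarticChar_pow_four hg hχ
  have hinv := quarticChar_inv hg hχ
  have h2 := quarticChar_sq_ne_one hχ
  set G1 := gaussSum χ ψ
  set G2 := gaussSum (χ ^ 2) ψ
  set G3 := gaussSum (χ ^ 3) ψ
  have r1 : G2 * jacobiSum χ χ = G1 * G1 := by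
    have := jacobiSum_mul_nontrivial (χ := χ) (φ := χ) (by rwa [← sq]) ψ
    rwa [← sq χ] at this
  have hχ6 : χ⁻¹ * χ⁻¹ = χ ^ 2 := by
    rw [hinv, ← pow_add, show 3 + 3 = 4 + 2 by norm_num, pow_add, h4, one_mul]
  have r3 : G2 * jacobiSum χ⁻¹ χ⁻¹ = G3 * G3 := by
    have := jacobiSum_mul_nontrivial (χ := χ⁻¹) (φ := χ⁻¹) (by rwa [hχ6]) ψ
    rwa [hχ6, show gaussSum χ⁻¹ ψ = G3 by rw [hinv]] at this
  have r13 : G1 * G3 = (-1) ^ k * (4 * k + 1 : ℕ) := gaussSum_mul_gaussSum_cube hg hχ hk hψ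
  have r22 : G2 * G2 = (4 * k + 1 : ℕ) := gaussSum_sq_mul_self hg hχ hk hψ
  rw [hJ] at r1
  rw [hJ'] at r3
  have hI := Complex.I_sq
  -- By `quarticSum_eq`, the sum on the class χ = c is c³G1 + c²G2 + cG3; U and V are its odd parts
  -- at c = 1 and c = i.
  refine ⟨G2, G1 + G3, Complex.I * (G3 - G1), fun c => c ^ 3 * G1 + c ^ 2 * G2 + c * G3,
    fun a => quarticSum_eq hg hχ hk hψ a, by ring, by ring, ?_, ?_, by rw [sq, r22], ?_, ?_, ?_⟩
  · simp only [Complex.I_pow_three, hI]; ring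
  · simp only [neg_pow Complex.I, Complex.I_pow_three, hI]; ring
  · linear_combination -r1 - r3 + 2 * r13
  · linear_combination (G3 - G1) ^ 2 * hI + r1 + r3 + 2 * r13
  · linear_combination Complex.I * r1 - Complex.I * r3 - 4 * t * G2 * hI

/-- The numerator of the generating function, depending on the value `w = χ y`, with
`ε = χ (-1)`. -/
def IsNumerator (q s t ε : ℚ) (w : ℂ) (N : ℚ⟦X⟧) : Prop :=
  (w = Complex.I ∧ N = -X + C (2 * s + 8 * t) * X ^ 2 + C ((1 - 2 * ε) * q - 8 * s * t) * X ^ 3) ∨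
  (w = -1 ∧ N = C (1 - 2 * ε) * X + C (2 * s) * X ^ 2 + C (3 * q - 4 * s ^ 2) * X ^ 3) ∨
  (w = -Complex.I ∧
    N = -X + C (2 * s - 8 * t) * X ^ 2 + C ((1 - 2 * ε) * q + 8 * s * t) * X ^ 3)

include hg hχ hk in
lemma genFun_eq_of_jacobiSum {s t : ℤ} (hJ : jacobiSum χ χ = -s + 2 * t * Complex.I)
    (hJ' : jacobiSum χ⁻¹ χ⁻¹ = -s - 2 * t * Complex.I) (y : Fˣ) {q : ℕ} (hq : q = 4 * k + 1)
    {N D : ℚ⟦X⟧} (hN : IsNumerator q s t ((-1) ^ k) (χ y) N)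
    (hD : D = 1 + C ((2 * (1 - 2 * (-1) ^ k) - 4) * q : ℚ) * X ^ 2 + C (8 * q * s : ℚ) * X ^ 3 +
      C ((1 - 2 * (-1) ^ k) ^ 2 * q ^ 2 - 4 * q * s ^ 2 : ℚ) * X ^ 4) :
    genFun F (y : F) =
      (q : ℚ⟦X⟧) * X * (1 - (q : ℚ⟦X⟧) * X)⁻¹ + ((q : ℚ⟦X⟧) - 1) * N * D⁻¹ := by
  have hψ := AddChar.FiniteField.primitiveChar_to_Complex_isPrimitive F
  set ψ := AddChar.FiniteField.primitiveChar_to_Complex F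
  refine genFun_eq_of_mul_eq hψ y.ne_zero (hk.trans hq.symm) (by simp [hD]) ?_
  obtain ⟨B, U, V, τ, hτ, t1, t2, t3, t4, hB, hU, hV, hUV⟩ := exists_periods hg hχ hk hψ hJ hJ'
  rw [← hq] at hB hU hV
  -- Grouping `a` by c = χ(a) leaves four geometric series in τ(c)X, with weights τ(c·χ(y)).
  have hS : (PowerSeries.mk fun n => ∑ a : Fˣ, quarticSum ψ a ^ n * quarticSum ψ (a * y)) =
      (k : ℂ⟦X⟧) * (C (τ (χ y)) * (PowerSeries.mk fun n => (τ 1) ^ n) +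
        C (τ (Complex.I * χ y)) * (PowerSeries.mk fun n => (τ Complex.I) ^ n) +
        C (τ (-χ y)) * (PowerSeries.mk fun n => (τ (-1)) ^ n) +
        C (τ (-Complex.I * χ y)) * (PowerSeries.mk fun n => (τ (-Complex.I)) ^ n)) := by
    ext n
    have e : ∀ a : Fˣ, quarticSum ψ a ^ n * quarticSum ψ (a * y) =
        (fun c => τ c ^ n * τ (c * χ y)) (χ a) := fun a => by
      rw [← Units.val_mul, hτ, hτ, Units.val_mul, map_mul]
    have hkC : (k : ℂ⟦X⟧) = C (k : ℂ) := by simp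
    rw [PowerSeries.coeff_mk, Finset.sum_congr rfl fun a _ => e a,
      sum_char hg hχ hk (fun c => τ c ^ n * τ (c * χ y)), hkC]
    simp only [PowerSeries.coeff_C_mul, map_add, PowerSeries.coeff_mk]
    rw [one_mul, neg_one_mul]
    ring
  rw [hS]
  have m1 := mk_pow_mul_one_sub (τ 1)
  have m2 := mk_pow_mul_one_sub (τ Complex.I)
  have m3 := mk_pow_mul_one_sub (τ (-1))
  have m4 := mk_pow_mul_one_sub (τ (-Complex.I))
  generalize (PowerSeries.mk fun n => (τ 1) ^ n) = M1 at *
  generalize (PowerSeries.mk fun n => (τ Complex.I) ^ n) = M2 at *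
  generalize (PowerSeries.mk fun n => (τ (-1)) ^ n) = M3 at *
  generalize (PowerSeries.mk fun n => (τ (-Complex.I)) ^ n) = M4 at *
  rw [t1] at m1; rw [t3] at m2; rw [t2] at m3; rw [t4] at m4
  have hBC := congrArg (C (R := ℂ)) hB
  have hUC := congrArg (C (R := ℂ)) hU
  have hVC := congrArg (C (R := ℂ)) hV
  have hUVC := congrArg (C (R := ℂ)) hUV
  simp only [map_mul, map_add, map_sub, map_pow, map_neg, map_natCast, map_intCast, map_ofNat,
    map_one] at hBC hUC hVC hUVC m1 m2 m3 m4
  have hDC : PowerSeries.map (algebraMap ℚ ℂ) D =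
      ((1 - (C B + C U) * X) * (1 - (C B - C U) * X)) *
    ((1 - (-C B + C V) * X) * (1 - (-C B - C V) * X)) := by
    rw [period_quartic hBC hUC hVC, hD]
    simp only [map_mul, map_add, map_sub, map_pow, map_neg, map_natCast, map_intCast, map_ofNat,
      map_one, PowerSeries.map_X]
  have hq4 : (q : ℂ⟦X⟧) - 1 = 4 * k := by rw [hq]; push_cast; ring
  rw [hDC, hq4]
  set l1 := 1 - (C B + C U) * (X : ℂ⟦X⟧) with hl1
  set l2 := 1 - (C B - C U) * (X : ℂ⟦X⟧) with hl2
  set l3 := 1 - (-C B + C V) * (X : ℂ⟦X⟧) with hl3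
  set l4 := 1 - (-C B - C V) * (X : ℂ⟦X⟧) with hl4
  rcases hN with ⟨hw, rfl⟩ | ⟨hw, rfl⟩ | ⟨hw, rfl⟩ <;> rw [hw]
  · rw [Complex.I_mul_I, neg_mul, Complex.I_mul_I, neg_neg, t1, t2, t3, t4]
    have key := period_numerator_I (X := (X : ℂ⟦X⟧)) hBC hUC hVC hUVC
    rw [← hl1, ← hl2, ← hl3, ← hl4] at key
    simp only [map_mul, map_add, map_sub, map_pow, map_neg, map_natCast, map_intCast, map_ofNat,
      map_one, PowerSeries.map_X]
    linear_combination (k : ℂ⟦X⟧) * (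
      (-C B + C V) * l2 * l3 * l4 * m1 + (C B - C U) * l1 * l2 * l4 * m2 +
      (-C B - C V) * l1 * l3 * l4 * m3 + (C B + C U) * l1 * l2 * l3 * m4 + key)
  · rw [mul_neg_one, neg_neg, neg_mul, mul_neg_one, neg_neg, t1, t2, t3, t4]
    have key := period_numerator_neg_one (X := (X : ℂ⟦X⟧)) hBC hUC hVC
      (by rw [← pow_mul, mul_comm, pow_mul]; simp)
    rw [← hl1, ← hl2, ← hl3, ← hl4] at key
    simp only [map_mul, map_add, map_sub, map_pow, map_neg, map_natCast, map_intCast, map_ofNat,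
      map_one, PowerSeries.map_X]
    linear_combination (k : ℂ⟦X⟧) * (
      (C B - C U) * l2 * l3 * l4 * m1 + (-C B - C V) * l1 * l2 * l4 * m2 +
      (C B + C U) * l1 * l3 * l4 * m3 + (-C B + C V) * l1 * l2 * l3 * m4 + key)
  · rw [mul_neg, Complex.I_mul_I, neg_neg, neg_mul_neg, Complex.I_mul_I, neg_neg, t1, t2, t3, t4]
    -- Replacing i by −i exchanges the classes of i and −i, which amounts to (V, t) ↦ (−V, −t).
    have key := period_numerator_I (X := (X : ℂ⟦X⟧)) (V := -C V) (t := -(t : ℂ⟦X⟧)) hBC hUC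
      (by rw [neg_sq, hVC]) (by linear_combination -hUVC)
    rw [← sub_eq_add_neg, sub_neg_eq_add, ← hl1, ← hl2, ← hl3, ← hl4] at key
    simp only [map_mul, map_add, map_sub, map_pow, map_neg, map_natCast, map_intCast, map_ofNat,
      map_one, PowerSeries.map_X]
    linear_combination (k : ℂ⟦X⟧) * (
      (-C B - C V) * l2 * l3 * l4 * m1 + (C B + C U) * l1 * l2 * l4 * m2 +
      (-C B + C V) * l1 * l3 * l4 * m3 + (C B - C U) * l1 * l2 * l3 * m4 + key)

end GaussRelations

/-! ### Binomial coefficients modulo p and sums of two squares -/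

section Arithmetic

lemma not_dvd_choose_of_lt {p n r : ℕ} (hp : p.Prime) (hn : n < p) (hr : r ≤ n) :
    ¬ p ∣ n.choose r := fun h => by
  have h1 : p ∣ n.factorial := by
    rw [← Nat.choose_mul_factorial_mul_factorial hr]
    exact Dvd.dvd.mul_right (Dvd.dvd.mul_right h _) _
  exact absurd ((Nat.Prime.dvd_factorial hp).1 h1) (by lia)

/-- Every base-p digit of k is r = (p−1)/4, and every digit of 3k is 3r < p. Lucas' theorem then
gives a product of factors C(3r, r), none divisible by p. -/
lemma not_dvd_choose_three_mul {p : ℕ} (hp : p.Prime) (hp4 : p % 4 = 1) (m : ℕ) :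
    ∀ k : ℕ, p ^ m = 4 * k + 1 → ¬ p ∣ (3 * k).choose k := by
  have := Fact.mk hp
  induction m with
  | zero =>
    intro k hk
    have : k = 0 := by simpa using hk
    subst this
    simpa using hp.one_lt.ne'
  | succ m ih =>
    intro k hk
    obtain ⟨r, hr⟩ : ∃ r, p = 4 * r + 1 := ⟨p / 4, by lia⟩
    obtain ⟨l, hl⟩ : ∃ l, p ^ m = 4 * l + 1 := by
      have : p ^ m % 4 = 1 := by rw [Nat.pow_mod, hp4]; simp
      exact ⟨p ^ m / 4, by lia⟩
    have hk' : k = r + p * l := by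
      rw [pow_succ, hl] at hk
      have : 4 * k + 1 = 4 * (r + p * l) + 1 := by
        rw [← hk]
        nth_rw 1 [hr]
        rw [show (4 * l + 1) * (4 * r + 1) = 4 * ((4 * r + 1) * l) + (4 * r + 1) by ring, ← hr]
        lia
      lia
    have h3k : 3 * k = 3 * r + p * (3 * l) := by rw [hk']; ring
    have h := Choose.choose_modEq_choose_mod_mul_choose_div_nat (n := 3 * k) (k := k) (p := p)
    rw [show (3 * k) % p = 3 * r by rw [h3k, Nat.add_mul_mod_self_left, Nat.mod_eq_of_lt (by lia)],
      show (3 * k) / p = 3 * l by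
        rw [h3k, Nat.add_mul_div_left _ _ hp.pos, Nat.div_eq_of_lt (by lia), zero_add],
      show k % p = r by rw [hk', Nat.add_mul_mod_self_left, Nat.mod_eq_of_lt (by lia)],
      show k / p = l by
        rw [hk', Nat.add_mul_div_left _ _ hp.pos, Nat.div_eq_of_lt (by lia), zero_add]] at h
    rw [h.dvd_iff (dvd_refl p), hp.dvd_mul, not_or]
    exact ⟨not_dvd_choose_of_lt hp (by lia) (by lia), ih l hl⟩

/-- Descent: −1 is not a square modulo p, so p divides both a and b, and p² can be cancelled. -/
lemma eq_zero_or_eq_zero_of_sq_add_sq_eq_pow {p : ℕ} (hp : p.Prime) (hp4 : p % 4 = 3) (n : ℕ) :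
    ∀ a b : ℤ, a ^ 2 + b ^ 2 = (p : ℤ) ^ (2 * n) → a = 0 ∨ b = 0 := by
  have := Fact.mk hp
  have hp0 : (p : ℤ) ≠ 0 := by exact_mod_cast hp.ne_zero
  induction n with
  | zero =>
    intro a b h
    by_contra! hab
    have ha := pow_pos (abs_pos.2 hab.1) 2
    have hb := pow_pos (abs_pos.2 hab.2) 2
    rw [sq_abs] at ha hb
    simp only [mul_zero, pow_zero] at h
    lia
  | succ n ih =>
    intro a b h
    have hz : (a : ZMod p) ^ 2 + (b : ZMod p) ^ 2 = 0 := by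
      have := congrArg (Int.cast : ℤ → ZMod p) h
      push_cast at this
      rw [this]
      simp
    have hb : (b : ZMod p) = 0 := by
      by_contra hb
      exact ZMod.mod_four_ne_three_of_sq_eq_neg_sq' hb (eq_neg_of_add_eq_zero_left hz) hp4
    have ha : (a : ZMod p) = 0 := by simpa [hb] using hz
    obtain ⟨a', rfl⟩ := (ZMod.intCast_zmod_eq_zero_iff_dvd a p).1 ha
    obtain ⟨b', rfl⟩ := (ZMod.intCast_zmod_eq_zero_iff_dvd b p).1 hb
    have := ih a' b' (mul_left_cancel₀ (pow_ne_zero 2 hp0) (by linear_combination h))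
    exact this.imp (fun h0 => by rw [h0, mul_zero]) (fun h0 => by rw [h0, mul_zero])

/-- Uniqueness of the representation `q = s² + 4t²` with the normalisation of `IsParam`. -/
lemma sq_add_four_sq_unique {p m : ℕ} (hp : p.Prime) (hp2 : p ≠ 2) {s t s' t' : ℤ}
    (h : ((p ^ m : ℕ) : ℤ) = s ^ 2 + 4 * t ^ 2) (h' : ((p ^ m : ℕ) : ℤ) = s' ^ 2 + 4 * t' ^ 2)
    (hs : ¬ (p : ℤ) ∣ s) (hs' : ¬ (p : ℤ) ∣ s') (h4 : s % 4 = 1) (h4' : s' % 4 = 1)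
    (hm : m ≠ 0) (hc : (p : ℤ) ∣ s * t' - s' * t) : s = s' ∧ t = t' := by
  have hpI : Prime (p : ℤ) := Nat.prime_iff_prime_int.1 hp
  have hp2' : ¬ (p : ℤ) ∣ 2 := fun hd => hp2 ((Nat.prime_dvd_prime_iff_eq hp Nat.prime_two).1
    (by exact_mod_cast hd))
  set q : ℤ := ((p ^ m : ℕ) : ℤ) with hq
  have hqpos : 0 < q := by
    rw [hq]
    exact_mod_cast pow_pos hp.pos m
  have hpq : (p : ℤ) ∣ q := by
    rw [hq]
    exact_mod_cast dvd_pow_self p hm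
  have h5 : 4 * ((s * t' - s' * t) * (s * t' + s' * t)) = q * (s ^ 2 - s' ^ 2) := by
    linear_combination (-s ^ 2) * h' + s' ^ 2 * h
  -- If p divided the sum as well as the difference `hc`, it would divide t', hence s'. So the whole
  -- power q divides the difference.
  have hcop : IsCoprime q (4 * (s * t' + s' * t)) := by
    rw [hq]
    push_cast
    refine IsCoprime.pow_left ((Prime.coprime_iff_not_dvd hpI).2 fun hd => ?_)
    have hd2 : (p : ℤ) ∣ s * t' + s' * t := by
      rcases hpI.dvd_mul.1 hd with hd | hd
      · exact absurd (hpI.dvd_of_dvd_pow (n := 2) (by norm_num [hd])) hp2'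
      · exact hd
    have hd3 : (p : ℤ) ∣ 2 * (s * t') := by
      have := dvd_add hc hd2
      rwa [show s * t' - s' * t + (s * t' + s' * t) = 2 * (s * t') by ring] at this
    have hd4 : (p : ℤ) ∣ t' := by
      rcases hpI.dvd_mul.1 hd3 with hd | hd
      · exact absurd hd hp2'
      · exact (hpI.dvd_mul.1 hd).resolve_left hs
    apply hs'
    apply hpI.dvd_of_dvd_pow (n := 2)
    rw [show s' ^ 2 = q - 4 * t' ^ 2 by rw [h']; ring]
    exact dvd_sub hpq (Dvd.dvd.mul_left (dvd_pow hd4 two_ne_zero) _)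
  have hqd : q ∣ s * t' - s' * t :=
    hcop.dvd_of_dvd_mul_right ⟨s ^ 2 - s' ^ 2, by linear_combination h5⟩
  have hsum : (s * s' + 4 * t * t') ^ 2 + 4 * (s * t' - s' * t) ^ 2 = q ^ 2 := by
    linear_combination (-q) * h - (s ^ 2 + 4 * t ^ 2) * h'
  -- A nonzero multiple of q would make the second term of `hsum` at least 4q² > q².
  have h0 : s * t' - s' * t = 0 := by
    by_contra hne
    have := Int.le_of_dvd (by positivity) ((pow_dvd_pow_of_dvd hqd 2).trans
      (dvd_refl ((s * t' - s' * t) ^ 2)))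
    nlinarith [sq_nonneg (s * s' + 4 * t * t'), pow_pos hqpos 2]
  have h6 : (s - s') * (s + s') = 0 := by
    have : q * ((s - s') * (s + s')) = 0 := by
      rw [h0] at h5
      linear_combination -h5
    exact (mul_eq_zero.1 this).resolve_left hqpos.ne'
  have hss : s = s' := by
    -- The case s = −s' contradicts s ≡ s' ≡ 1 (mod 4).
    rcases mul_eq_zero.1 h6 with h7 | h7 <;> lia
  subst hss
  have hs0 : s ≠ 0 := by rintro rfl; exact hs (dvd_zero _)
  exact ⟨rfl, (mul_left_cancel₀ hs0 (by linear_combination h0)).symm⟩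

end Arithmetic

/-! ### Power sums over F -/

section PowerSums

variable {F : Type*} [Field F] [Fintype F]

lemma sum_pow_mul_one_sub_pow (e : ℕ) : ∑ a : F, a ^ e * (1 - a) ^ e =
    ∑ j ∈ Finset.range (e + 1), (-1) ^ j * (e.choose j : F) * ∑ a : F, a ^ (e + j) := by
  simp_rw [Finset.mul_sum]
  rw [Finset.sum_comm]
  refine Finset.sum_congr rfl fun a _ => ?_
  rw [sub_eq_neg_add, add_pow, Finset.mul_sum]
  refine Finset.sum_congr rfl fun j _ => ?_
  rw [neg_pow a j, one_pow, pow_add]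
  ring

lemma sum_pow_field {n : ℕ} (hn : Fintype.card F = n + 1) {i : ℕ} (hi : i ≠ 0) :
    ∑ a : F, a ^ i = if n ∣ i then -1 else 0 := by
  classical
  rw [Fintype.sum_eq_add_sum_subtype_ne _ (0 : F), zero_pow hi, zero_add,
    ← Fintype.sum_equiv unitsEquivNeZero (fun u : Fˣ => (u : F) ^ i) _ fun a => rfl,
    FiniteField.sum_pow_units, hn, Nat.add_sub_cancel]

variable {k : ℕ} (hk : Fintype.card F = 4 * k + 1)

include hk in
-- All exponents in the expansion lie between k and 2k, below q − 1 = 4k.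
lemma sum_pow_mul_one_sub_pow_eq_zero : ∑ a : F, a ^ k * (1 - a) ^ k = 0 := by
  have hk0 : 0 < k := by
    have := Fintype.one_lt_card (α := F)
    lia
  rw [sum_pow_mul_one_sub_pow]
  refine Finset.sum_eq_zero fun j hj => ?_
  rw [Finset.mem_range] at hj
  rw [FiniteField.sum_pow_lt_card_sub_one, mul_zero]
  rw [hk]
  lia

include hk in
-- The exponents run from 3k to 6k, and 4k is the only multiple of q − 1 among them.
lemma sum_pow_three_mul_mul_one_sub_pow :
    ∑ a : F, a ^ (3 * k) * (1 - a) ^ (3 * k) = -((-1) ^ k * ((3 * k).choose k : F)) := by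
  have hk0 : 0 < k := by
    have := Fintype.one_lt_card (α := F)
    lia
  rw [sum_pow_mul_one_sub_pow, Finset.sum_eq_single k]
  · rw [sum_pow_field hk (by lia), if_pos ⟨1, by ring⟩]
    ring
  · intro j hj hjk
    rw [Finset.mem_range] at hj
    rw [sum_pow_field hk (by lia), if_neg, mul_zero]
    rintro ⟨c, hc⟩
    have hc1 : c < 2 := by
      by_contra! h
      have := Nat.mul_le_mul_left (4 * k) h
      lia
    interval_cases c <;> lia
  · intro h
    exact absurd (Finset.mem_range.2 (by lia)) h

end PowerSums

/-! ### The Jacobi sum J(χ, χ) in ℤ[i] -/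

section JacobiSum

/-- The Gaussian integer `i`. -/
def gaussI : GaussianInt := ⟨0, 1⟩

lemma gaussI_sq : gaussI * gaussI = -1 := by ext <;> simp [gaussI]

lemma toComplex_gaussI : GaussianInt.toComplex gaussI = Complex.I := by
  simp [gaussI, GaussianInt.toComplex_def]

variable {F : Type*} [Field F] {g : Fˣ} (hg : ∀ u : Fˣ, u ∈ Subgroup.zpowers g)
  {χ : MulChar F GaussianInt} (hχ : χ g = gaussI)

include hχ in
lemma gaussian_char_toComplex : χ.ringHomComp GaussianInt.toComplex g = Complex.I := by
  rw [MulChar.ringHomComp_apply, hχ, toComplex_gaussI]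

include hχ in
lemma gaussian_char_ne_one : χ ≠ 1 := fun h =>
  quarticChar_ne_one (gaussian_char_toComplex hχ) (by rw [h]; exact MulChar.ringHomComp_one _)

include hχ in
lemma gaussian_char_sq_ne_one : χ ^ 2 ≠ 1 := fun h =>
  quarticChar_sq_ne_one (gaussian_char_toComplex hχ) (by
    rw [MulChar.ringHomComp_pow, h]; exact MulChar.ringHomComp_one _)

variable [Fintype F] {k : ℕ} (hk : Fintype.card F = 4 * k + 1)

include hg hk in
-- Values in ℤ[i] rather than ℂ allow divisibility arguments and ring homomorphisms to F.
lemma exists_gaussian_char : ∃ χ : MulChar F GaussianInt, χ g = gaussI := by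
  classical
  let ζ : GaussianIntˣ := ⟨gaussI, -gaussI, by rw [mul_neg, gaussI_sq, neg_neg],
    by rw [neg_mul, gaussI_sq, neg_neg]⟩
  have hζ : ζ ∈ rootsOfUnity (Fintype.card Fˣ) GaussianInt := by
    rw [Fintype.card_units, hk, Nat.add_sub_cancel, mem_rootsOfUnity, pow_mul]
    have : ζ ^ 4 = 1 := by
      ext1
      change gaussI ^ 4 = 1
      rw [show gaussI ^ 4 = (gaussI * gaussI) * (gaussI * gaussI) by ring, gaussI_sq]
      norm_num
    rw [this, one_pow]
  exact ⟨MulChar.ofRootOfUnity hζ hg, MulChar.ofRootOfUnity_spec hζ hg⟩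

include hg hχ in
lemma gaussian_char_cases (u : Fˣ) :
    χ u = 1 ∨ χ u = gaussI ∨ χ u = -1 ∨ χ u = -gaussI := by
  have h := char_unit_cases hg (gaussian_char_toComplex hχ) u
  rw [MulChar.ringHomComp_apply, ← toComplex_gaussI] at h
  refine h.imp (fun h => ?_) (Or.imp (fun h => ?_) (Or.imp (fun h => ?_) (fun h => ?_))) <;>
    apply GaussianInt.toComplex_injective <;> simp [h]

include hg hχ in
/-- A ring homomorphism `ℤ[i] → F` with `i ↦ g ^ e` turns the quartic character into the power map
with exponent `e`. -/
lemma lift_jacobiSum {r : F} (hr : r * r = ((-1 : ℤ) : F)) {e : ℕ} (he : e ≠ 0)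
    (hre : r = (g : F) ^ e) :
    Zsqrtd.lift ⟨r, hr⟩ (jacobiSum χ χ) = ∑ a : F, a ^ e * (1 - a) ^ e := by
  have h : ∀ a : F, Zsqrtd.lift ⟨r, hr⟩ (χ a) = a ^ e := by
    intro a
    rcases eq_or_ne a 0 with rfl | ha
    · rw [MulChar.map_zero, map_zero, zero_pow he]
    · obtain ⟨n, hn⟩ := exists_pow_generator hg (Units.mk0 a ha)
      have hn' : a = (g : F) ^ n := by
        rw [← Units.val_pow_eq_pow_val, hn, Units.val_mk0]
      rw [hn', map_pow, map_pow, hχ, ← pow_mul, mul_comm n, pow_mul, ← hre]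
      simp [gaussI, Zsqrtd.lift]
  simp only [jacobiSum, map_sum, map_mul, h]

include hg hχ in
-- The left side equals Σ (χ(x) − 1)(χ²(1−x) − 1). The terms x = 0, 1 vanish; elsewhere i − 1
-- divides the first factor and 2 the second.
lemma dvd_jacobiSum_add_card :
    2 * (gaussI - 1) ∣ jacobiSum χ (χ ^ 2) + (Fintype.card F : GaussianInt) := by
  have h : jacobiSum χ (χ ^ 2) + (Fintype.card F : GaussianInt) =
      ∑ x : F, (χ x - 1) * ((χ ^ 2) (1 - x) - 1) := by
    have e : ∀ x : F, (χ x - 1) * ((χ ^ 2) (1 - x) - 1) =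
        χ x * (χ ^ 2) (1 - x) - χ x - (χ ^ 2) (1 - x) + 1 := fun x => by ring
    have e2 : ∑ x : F, (χ ^ 2) (1 - x) = 0 := by
      rw [← MulChar.sum_eq_zero_of_ne_one (gaussian_char_sq_ne_one hχ)]
      exact (Equiv.subLeft (1 : F)).sum_comp (fun x => (χ ^ 2) x)
    simp only [e, Finset.sum_add_distrib, Finset.sum_sub_distrib,
      MulChar.sum_eq_zero_of_ne_one (gaussian_char_ne_one hχ), e2]
    simp [jacobiSum]
  rw [h]
  refine Finset.dvd_sum fun x _ => ?_
  rcases eq_or_ne x 0 with rfl | hx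
  · simp
  rcases eq_or_ne x 1 with rfl | hx1
  · simp
  rw [mul_comm (2 : GaussianInt)]
  refine mul_dvd_mul ?_ ?_
  · have := gaussian_char_cases hg hχ (Units.mk0 x hx)
    rw [Units.val_mk0] at this
    rcases this with h | h | h | h <;> rw [h]
    · simp
    · exact ⟨gaussI + 1, by linear_combination -gaussI_sq⟩
    · exact ⟨gaussI, by linear_combination -gaussI_sq⟩
  · have := gaussian_char_cases hg hχ (Units.mk0 (1 - x) (sub_ne_zero.2 hx1.symm))
    rw [Units.val_mk0] at this
    rw [MulChar.pow_apply' _ two_ne_zero]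
    rcases this with h | h | h | h <;> rw [h]
    · simp
    · exact ⟨-1, by linear_combination gaussI_sq⟩
    · simp
    · exact ⟨-1, by linear_combination gaussI_sq⟩

include hg hk hχ in
-- Both sides become equal after multiplication by q = G(χ²)²: combine G(χ)² = G(χ²)J(χ,χ),
-- G(χ)G(χ²) = G(χ³)J(χ,χ²) and G(χ)G(χ³) = (−1)ᵏq.
lemma jacobiSum_self_eq : jacobiSum χ χ = (-1) ^ k * jacobiSum χ (χ ^ 2) := by
  classical
  have hc := gaussian_char_toComplex hχ
  have hψ := AddChar.FiniteField.primitiveChar_to_Complex_isPrimitive F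
  set ψ := AddChar.FiniteField.primitiveChar_to_Complex F
  set φ := χ.ringHomComp GaussianInt.toComplex
  have r13 := gaussSum_mul_gaussSum_cube hg hc hk hψ
  have r22 := gaussSum_sq_mul_self hg hc hk hψ
  have r1 := jacobiSum_mul_nontrivial (χ := φ) (φ := φ)
    (by rw [← sq]; exact quarticChar_sq_ne_one hc) ψ
  have h3 : φ * φ ^ 2 ≠ 1 := by
    rw [← pow_succ', ← quarticChar_inv hg hc, inv_ne_one]
    exact quarticChar_ne_one hc
  have r2 := jacobiSum_mul_nontrivial (χ := φ) (φ := φ ^ 2) h3 ψ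
  rw [← sq φ] at r1
  rw [← pow_succ' φ 2] at r2
  have hq0 : ((4 * k + 1 : ℕ) : ℂ) ≠ 0 := by exact_mod_cast Nat.succ_ne_zero (4 * k)
  have key : jacobiSum φ φ = (-1) ^ k * jacobiSum φ (φ ^ 2) := by
    apply mul_left_cancel₀ hq0
    linear_combination gaussSum (φ ^ 2) ψ * r1 - gaussSum φ ψ * r2 - jacobiSum φ φ * r22 +
      jacobiSum φ (φ ^ 2) * r13
  apply GaussianInt.toComplex_injective
  rw [map_mul, map_pow, map_neg, map_one, ← jacobiSum_ringHomComp, ← jacobiSum_ringHomComp,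
    ← MulChar.ringHomComp_pow]
  exact key

lemma jacobiSum_inv_toComplex (χ : MulChar F GaussianInt) :
    jacobiSum (χ.ringHomComp GaussianInt.toComplex)⁻¹ (χ.ringHomComp GaussianInt.toComplex)⁻¹ =
      GaussianInt.toComplex (star (jacobiSum χ χ)) := by
  rw [GaussianInt.toComplex_star, ← jacobiSum_ringHomComp]
  simp only [jacobiSum, map_sum, map_mul, ← MulChar.star_apply']
  rfl

include hk hχ in
lemma norm_jacobiSum :
    (jacobiSum χ χ).re ^ 2 + (jacobiSum χ χ).im ^ 2 = ((4 * k + 1 : ℕ) : ℤ) := by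
  have hc := gaussian_char_toComplex hχ
  have hne : ringChar ℂ ≠ ringChar F := by
    rw [ringChar.eq_zero]
    exact (CharP.ringChar_ne_zero_of_finite F).symm
  have h := jacobiSum_mul_jacobiSum_inv hne (quarticChar_ne_one hc) (quarticChar_ne_one hc)
    (by rw [← sq]; exact quarticChar_sq_ne_one hc)
  rw [jacobiSum_inv_toComplex, jacobiSum_ringHomComp, ← map_mul, hk] at h
  have h' : jacobiSum χ χ * star (jacobiSum χ χ) = ((4 * k + 1 : ℕ) : GaussianInt) := by
    apply GaussianInt.toComplex_injective
    rw [h, map_natCast]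
  have := congrArg Zsqrtd.re h'
  rw [Zsqrtd.re_natCast] at this
  rw [← this]
  simp [sq]

include hg hk hχ in
lemma jacobiSum_congr : (jacobiSum χ χ).re % 4 = 3 ∧ (jacobiSum χ χ).im % 2 = 0 := by
  have hn := norm_jacobiSum hχ hk
  have hJ := jacobiSum_self_eq hg hχ hk
  obtain ⟨z, hz⟩ := dvd_jacobiSum_add_card hg hχ
  rw [hk] at hz
  have hre := congrArg Zsqrtd.re hz
  have him := congrArg Zsqrtd.im hz
  simp only [gaussI, Zsqrtd.re_add, Zsqrtd.im_add, Zsqrtd.re_mul, Zsqrtd.im_mul, Zsqrtd.re_sub,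
    Zsqrtd.im_sub, Zsqrtd.re_one, Zsqrtd.im_one, Zsqrtd.re_natCast, Zsqrtd.im_natCast,
    Zsqrtd.re_ofNat, Zsqrtd.im_ofNat] at hre him
  push_cast at hre hn
  set K := jacobiSum χ (χ ^ 2)
  obtain ⟨c, hc⟩ : ∃ c, K.re = 2 * c + 1 := ⟨-(2 * k + 1) - z.re - z.im, by lia⟩
  obtain ⟨d, hd⟩ : ∃ d, K.im = 2 * d := ⟨z.re - z.im, by lia⟩
  have hnK : K.re ^ 2 + K.im ^ 2 = 4 * k + 1 := by
    rw [← hn, hJ]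
    rcases neg_one_pow_eq_or GaussianInt k with h | h <;> rw [h] <;> simp
  rw [hc, hd] at hnK
  -- The norm equation gives d ≡ k (mod 2). The divisibility gives c ≡ d + 1, so re K ≡ 3 + 2k (mod
  -- 4), and the sign (−1)ᵏ normalises this to 3.
  have hcd : c * (c + 1) + d * d = k := by linarith
  have hc2 : c * (c + 1) % 2 = 0 := Int.even_iff.1 (Int.even_mul_succ_self c)
  have hd2 : d * d % 2 = d % 2 := by
    rcases Int.emod_two_eq_zero_or_one d with h | h <;> rw [Int.mul_emod, h] <;> rfl
  rw [hJ]
  rcases Nat.even_or_odd k with h | h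
  · rw [h.neg_one_pow, one_mul]
    obtain ⟨l, rfl⟩ := h
    lia
  · rw [h.neg_one_pow, neg_one_mul, Zsqrtd.re_neg, Zsqrtd.im_neg]
    obtain ⟨l, rfl⟩ := h
    lia

end JacobiSum

/-! ### Existence and uniqueness of s and t -/

section Parameters

variable {F : Type*} [Field F] {g : Fˣ} (hg : ∀ u : Fˣ, u ∈ Subgroup.zpowers g) [Fintype F]
  {χ : MulChar F GaussianInt} (hχ : χ g = gaussI) {p m k : ℕ} (hp : p.Prime)
  (hk : Fintype.card F = 4 * k + 1) (hq : p ^ m = 4 * k + 1)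

include hp hq hk in
lemma charP_of_card_eq_pow : CharP F p := by
  have : Fact p.Prime := ⟨hp⟩
  exact charP_of_card_eq_prime_pow (hk.trans hq.symm)

include hg hχ hp hk hq in
/-- The parameters `s, t` are given by the Jacobi sum of the quartic character. -/
lemma exists_isParam_jacobiSum : ∃ s t : ℤ, IsParam p m (4 * k + 1) g s t ∧
    (jacobiSum χ χ).re = -s ∧ (jacobiSum χ χ).im = 2 * t := by
  classical
  have hF := charP_of_card_eq_pow hp hk hq
  have hn := norm_jacobiSum hχ hk
  obtain ⟨hre, him⟩ := jacobiSum_congr hg hχ hk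
  have hk0 : 0 < k := by
    have := Fintype.one_lt_card (α := F)
    lia
  set J := jacobiSum χ χ with hJ
  obtain ⟨t, ht⟩ : ∃ t, J.im = 2 * t := ⟨J.im / 2, by lia⟩
  refine ⟨-J.re, t, ⟨fun hp4 => ?_, fun hp4 => ?_⟩, by ring, ht⟩
  · have h2k : (g : F) ^ (2 * k) = -1 := by
      rw [← Units.val_pow_eq_pow_val, generator_pow_two_mul hg hk]; rfl
    have hr1 : (g : F) ^ k * (g : F) ^ k = ((-1 : ℤ) : F) := by
      rw [← pow_add, ← two_mul, h2k]; simp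
    have hr3 : (g : F) ^ (3 * k) * (g : F) ^ (3 * k) = ((-1 : ℤ) : F) := by
      rw [← pow_add, show 3 * k + 3 * k = 2 * k + 2 * k + 2 * k by ring, pow_add, pow_add, h2k]
      simp
    -- The two homomorphisms ℤ[i] → F: `e1` yields the congruence for t, `e3` yields p ∤ s.
    have e1 := lift_jacobiSum hg hχ hr1 hk0.ne' rfl
    have e3 := lift_jacobiSum hg hχ hr3 (by lia) rfl
    rw [sum_pow_mul_one_sub_pow_eq_zero hk, ← hJ, Zsqrtd.lift_apply_apply, ht] at e1
    rw [sum_pow_three_mul_mul_one_sub_pow hk, ← hJ, Zsqrtd.lift_apply_apply, ht] at e3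
    push_cast at e1 e3
    have h13 : (g : F) ^ k * (g : F) ^ (3 * k) = 1 := by
      rw [← pow_add, show k + 3 * k = 2 * k + 2 * k by ring, pow_add, h2k]
      simp
    have hexp : 3 * (4 * k + 1 - 1) / 4 = 3 * k := by lia
    have hrel : 2 * (t : F) = ((-J.re : ℤ) : F) * (g : F) ^ (3 * k) := by
      push_cast
      linear_combination (g : F) ^ (3 * k) * e1 - 2 * t * h13
    refine ⟨by rw [← hn, ht]; ring, ?_, ?_, by rw [hexp, hrel]⟩
    · rw [← Int.isCoprime_iff_gcd_eq_one,
        Prime.coprime_iff_not_dvd (Nat.prime_iff_prime_int.1 hp)]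
      intro hd
      have h0 : (J.re : F) = 0 := (CharP.intCast_eq_zero_iff F p _).2 (by simpa using hd)
      push_cast at hrel
      rw [h0, neg_zero, zero_mul] at hrel
      rw [h0, hrel, zero_mul, add_zero, eq_comm, neg_eq_zero] at e3
      have hch : ((3 * k).choose k : F) = 0 := by
        simpa using e3
      exact not_dvd_choose_three_mul hp hp4 m k hq ((CharP.cast_eq_zero_iff F p _).1 hch)
    · rw [Int.ModEq]
      lia
  · have hm : ∃ n, m = 2 * n := by
      rcases Nat.even_or_odd m with h | h
      · exact h.exists_two_nsmul _ |>.imp fun n hn => by simpa using hn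
      · exfalso
        obtain ⟨n, rfl⟩ := h
        have : p ^ (2 * n + 1) % 4 = 3 := by
          rw [pow_succ, pow_mul, Nat.mul_mod, Nat.pow_mod, Nat.pow_mod p, hp4]
          simp
        lia
    obtain ⟨n, rfl⟩ := hm
    have hmod : (-(p : ℤ)) ^ n % 4 = 1 := by
      have : (-(p : ℤ)) % 4 = 1 := by lia
      have h1 : (-(p : ℤ)) ^ n ≡ 1 ^ n [ZMOD 4] := Int.ModEq.pow n this
      rw [one_pow] at h1
      exact h1
    have h0 := eq_zero_or_eq_zero_of_sq_add_sq_eq_pow hp hp4 n J.re J.im (by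
      rw [hn, ← hq]; push_cast; rfl)
    -- The real part is odd, so it is the imaginary part that vanishes; the sign of s is then
    -- settled modulo 4 by (−p)ⁿ ≡ 1.
    have him0 : J.im = 0 := by
      refine h0.resolve_left fun h => ?_
      rw [h] at hre
      norm_num at hre
    rw [Nat.mul_div_cancel_left n two_pos]
    refine ⟨?_, by lia⟩
    have hsq : (-J.re - (-(p : ℤ)) ^ n) * (-J.re + (-(p : ℤ)) ^ n) = 0 := by
      have h5 : ((-(p : ℤ)) ^ n) ^ 2 = ((4 * k + 1 : ℕ) : ℤ) := by
        rw [← hq, ← pow_mul, mul_comm n, Even.neg_pow (even_two_mul n)]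
        push_cast; rfl
      rw [him0] at hn
      linear_combination hn - h5
    rcases mul_eq_zero.1 hsq with h | h <;> lia

include hp hk hq in
lemma isParam_unique (hp2 : p ≠ 2) {s t s' t' : ℤ} (h : IsParam p m (4 * k + 1) g s t)
    (h' : IsParam p m (4 * k + 1) g s' t') : s = s' ∧ t = t' := by
  have hF := charP_of_card_eq_pow hp hk hq
  have hp4 : p % 4 = 1 ∨ p % 4 = 3 := by
    have := hp.eq_two_or_odd
    lia
  rcases hp4 with hp4 | hp4
  · obtain ⟨h1, h2, h3, h4⟩ := h.1 hp4
    obtain ⟨h1', h2', h3', h4'⟩ := h'.1 hp4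
    have hnd : ∀ x : ℤ, Int.gcd p x = 1 → ¬ (p : ℤ) ∣ x := fun x hx => by
      rwa [← Int.isCoprime_iff_gcd_eq_one,
        Prime.coprime_iff_not_dvd (Nat.prime_iff_prime_int.1 hp)] at hx
    rw [← hq] at h1 h1'
    have hm : m ≠ 0 := by
      rintro rfl
      have := Fintype.one_lt_card (α := F)
      rw [hk, ← hq] at this
      simp at this
    refine sq_add_four_sq_unique hp hp2 h1 h1' (hnd _ h2) (hnd _ h2') h3 h3' hm ?_
    rw [← CharP.intCast_eq_zero_iff F p]
    have h20 : (2 : F) ≠ 0 := by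
      intro h0
      have h0' : ((2 : ℕ) : F) = 0 := by exact_mod_cast h0
      rw [CharP.cast_eq_zero_iff F p, Nat.prime_dvd_prime_iff_eq hp Nat.prime_two] at h0'
      exact hp2 h0'
    -- The two congruences have the same multiplier g^{3(q−1)/4}, so cross-multiplying eliminates
    -- it.
    apply mul_left_cancel₀ h20
    push_cast
    linear_combination (s : F) * h4' - (s' : F) * h4
  · obtain ⟨rfl, rfl⟩ := h.2 hp4
    obtain ⟨rfl, rfl⟩ := h'.2 hp4
    exact ⟨rfl, rfl⟩

end Parameters

/-! ### The case q ≡ 3 (mod 4) -/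

section ThreeModFour

variable {F : Type*} [Field F] [Fintype F] (hF : Fintype.card F % 4 = 3)

include hF in
lemma not_isSquare_neg_one : ¬ IsSquare (-1 : F) := by
  rw [FiniteField.isSquare_neg_one_iff]
  lia

include hF in
lemma ringChar_ne_two : ringChar F ≠ 2 := fun h => by
  have := FiniteField.even_card_iff_char_two.1 h
  lia

variable [DecidableEq F]

/-- The quadratic character with complex values. -/
noncomputable def complexQuadraticChar (F : Type*) [Field F] [Fintype F] [DecidableEq F] :
    MulChar F ℂ := (quadraticChar F).ringHomComp (Int.castRingHom ℂ)

lemma complexQuadraticChar_apply (a : F) :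
    complexQuadraticChar F a = (quadraticChar F a : ℂ) := rfl

include hF in
lemma complexQuadraticChar_neg_one : complexQuadraticChar F (-1) = -1 := by
  rw [complexQuadraticChar_apply,
    quadraticChar_neg_one_iff_not_isSquare.2 (not_isSquare_neg_one hF)]
  norm_num

include hF in
lemma complexQuadraticChar_ne_one : complexQuadraticChar F ≠ 1 := fun h => by
  have h1 := complexQuadraticChar_neg_one hF
  rw [h, show (-1 : F) = ((-1 : Fˣ) : F) by simp, MulChar.one_apply_coe] at h1
  norm_num at h1

lemma complexQuadraticChar_sq (a : Fˣ) : complexQuadraticChar F a ^ 2 = 1 := by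
  rw [complexQuadraticChar_apply]
  exact_mod_cast quadraticChar_sq_one a.ne_zero

include hF in
-- As −1 is not a square, one of w and −w is a square x², and then w² = x⁴.
lemma exists_pow_four_eq_iff (v : Fˣ) : (∃ z : Fˣ, z ^ 4 = v) ↔ IsSquare (v : F) := by
  constructor
  · rintro ⟨z, rfl⟩
    exact ⟨(z : F) ^ 2, by rw [Units.val_pow_eq_pow_val]; ring⟩
  · rintro ⟨w, hw⟩
    have hw0 : w ≠ 0 := by
      rintro rfl
      simp at hw
    obtain ⟨x, hx⟩ : ∃ x, x ^ 4 = (v : F) := by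
      by_cases hs : IsSquare w
      · obtain ⟨x, rfl⟩ := hs
        exact ⟨x, by rw [hw]; ring⟩
      · have : IsSquare (-w) := by
          rw [← quadraticChar_one_iff_isSquare (neg_ne_zero.2 hw0), neg_eq_neg_one_mul, map_mul,
            quadraticChar_neg_one_iff_not_isSquare.2 hs,
            quadraticChar_neg_one_iff_not_isSquare.2 (not_isSquare_neg_one hF)]
          norm_num
        obtain ⟨x, hx⟩ := this
        exact ⟨x, by rw [hw]; linear_combination (-x * x + w) * hx⟩
    have hx0 : x ≠ 0 := by
      rintro rfl
      exact v.ne_zero (by simpa using hx.symm)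
    exact ⟨Units.mk0 x hx0, Units.ext (by simpa using hx)⟩

include hF in
lemma card_pow_four_eq_one_of_card_mod_four :
    Finset.card {u : Fˣ | u ^ 4 = 1} = 2 := by
  have : ({u : Fˣ | u ^ 4 = 1} : Finset Fˣ) = {1, -1} := by
    ext u
    simp only [Finset.mem_filter, Finset.mem_univ, true_and, Finset.mem_insert,
      Finset.mem_singleton]
    constructor
    · intro h
      have h' : (u : F) ^ 4 = 1 := by rw [← Units.val_pow_eq_pow_val, h, Units.val_one]
      have h2 : ((u : F) ^ 2 + 1) * (((u : F) - 1) * (u + 1)) = 0 := by linear_combination h'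
      rcases mul_eq_zero.1 h2 with h3 | h3
      · exact absurd ⟨(u : F), by linear_combination -h3⟩ (not_isSquare_neg_one hF)
      · exact (mul_eq_zero.1 h3).imp (fun h => Units.ext (by simpa [sub_eq_zero] using h))
          (fun h => Units.ext (by simpa [add_eq_zero_iff_eq_neg] using h))
    · rintro (rfl | rfl)
      · simp
      · rw [Even.neg_pow (by decide), one_pow]
  rw [this, Finset.card_pair]
  intro h
  exact Ring.neg_one_ne_one_of_char_ne_two (ringChar_ne_two hF)
    (by simpa using congrArg Units.val h.symm)

include hF in
lemma complexQuadraticChar_count (v : Fˣ) :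
    1 + complexQuadraticChar F v = (Finset.card {u : Fˣ | u ^ 4 = v} : ℂ) := by
  rw [card_filter_pow_four_eq, card_pow_four_eq_one_of_card_mod_four hF,
    complexQuadraticChar_apply]
  simp only [exists_pow_four_eq_iff hF]
  split_ifs with h
  · rw [(quadraticChar_one_iff_isSquare v.ne_zero).2 h]; norm_num
  · rw [quadraticChar_neg_one_iff_not_isSquare.2 h]; norm_num

include hF in
lemma quarticSum_eq_of_card_mod_four {ψ : AddChar F ℂ} (hψ : ψ.IsPrimitive) (a : Fˣ) :
    quarticSum ψ a = complexQuadraticChar F a * gaussSum (complexQuadraticChar F) ψ := by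
  have h0 : ∑ b : F, ψ.mulShift a b = 0 := by
    have := AddChar.sum_mulShift (a : F) hψ
    simpa [mul_comm, AddChar.mulShift_apply] using this
  have h00 : 1 + complexQuadraticChar F 0 = 1 := by rw [MulChar.map_zero, add_zero]
  have hs : quarticSum ψ a = gaussSum (complexQuadraticChar F) (ψ.mulShift a) := by
    rw [quarticSum, sum_pow_four (N := fun b => 1 + complexQuadraticChar F b) h00
      (fun v => complexQuadraticChar_count hF v) (fun b => ψ (a * b))]
    refine Eq.trans ?_ ((congrArg (· + _) h0).trans (zero_add _))
    rw [gaussSum, ← Finset.sum_add_distrib]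
    refine Finset.sum_congr rfl fun b _ => ?_
    rw [AddChar.mulShift_apply]
    ring
  rw [hs, ← gaussSum_mulShift (complexQuadraticChar F) ψ a, ← mul_assoc, ← sq,
    complexQuadraticChar_sq, one_mul]

include hF in
lemma sum_complexQuadraticChar : ∑ a : Fˣ, complexQuadraticChar F a = 0 := by
  have h := MulChar.sum_eq_zero_of_ne_one (complexQuadraticChar_ne_one hF)
  rw [Fintype.sum_eq_add_sum_subtype_ne _ (0 : F), MulChar.map_zero, zero_add] at h
  rw [← h]
  exact Fintype.sum_equiv unitsEquivNeZero _ _ fun a => rfl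

include hF in
lemma genFun_eq_of_card_mod_four {q : ℕ} (hq : Fintype.card F = q) (y : Fˣ)
    (hy : ¬ ∃ z : F, z ^ 4 = (y : F)) :
    genFun F (y : F) =
      (q : ℚ⟦X⟧) * X * (1 - (q : ℚ⟦X⟧) * X)⁻¹ +
        ((q : ℚ⟦X⟧) - 1) * X * (1 + (q : ℚ⟦X⟧) * X ^ 2)⁻¹ := by
  have hψ := AddChar.FiniteField.primitiveChar_to_Complex_isPrimitive F
  set ψ := AddChar.FiniteField.primitiveChar_to_Complex F
  refine genFun_eq_of_mul_eq hψ y.ne_zero hq (by simp) ?_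
  set ρ := complexQuadraticChar F
  have hρy : ρ y = -1 := by
    have : ¬ IsSquare (y : F) := by
      rw [← exists_pow_four_eq_iff hF]
      rintro ⟨z, rfl⟩
      exact hy ⟨z, by simp⟩
    rw [complexQuadraticChar_apply, quadraticChar_neg_one_iff_not_isSquare.2 this]
    norm_num
  have hG : gaussSum ρ ψ ^ 2 = -q := by
    rw [gaussSum_sq (complexQuadraticChar_ne_one hF)
      ((quadraticChar_isQuadratic F).comp (Int.castRingHom ℂ)) hψ,
      complexQuadraticChar_neg_one hF, hq, neg_one_mul]
  set G := gaussSum ρ ψ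
  have hS : (PowerSeries.mk fun n => ∑ a : Fˣ, quarticSum ψ a ^ n * quarticSum ψ (a * y)) =
      ∑ a : Fˣ, -C (ρ a * G) * (PowerSeries.mk fun n => (ρ a * G) ^ n) := by
    ext n
    rw [PowerSeries.coeff_mk, map_sum]
    refine Finset.sum_congr rfl fun a _ => ?_
    rw [← map_neg, PowerSeries.coeff_C_mul, PowerSeries.coeff_mk, ← Units.val_mul,
      quarticSum_eq_of_card_mod_four hF hψ, quarticSum_eq_of_card_mod_four hF hψ, Units.val_mul,
      map_mul]
    change (ρ a * G) ^ n * (ρ a * ρ y * G) = _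
    rw [hρy]
    ring
  -- Since (ρ(a)G)² = −q, the denominator factors as (1 − ρ(a)GX)(1 + ρ(a)GX). The term linear in
  -- ρ(a) then cancels on summing over `a`.
  have hterm : ∀ a : Fˣ, -C (ρ a * G) * (PowerSeries.mk fun n => (ρ a * G) ^ n) *
      (1 + (q : ℂ⟦X⟧) * X ^ 2) = -C (ρ a) * C G + (q : ℂ⟦X⟧) * X := by
    intro a
    have h1 := mk_pow_mul_one_sub (ρ a * G)
    have h2 := congrArg (C (R := ℂ)) (show (ρ a * G) ^ 2 = -q by
      rw [mul_pow, complexQuadraticChar_sq, one_mul, hG])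
    simp only [map_mul, map_pow, map_neg, map_natCast] at h1 h2 ⊢
    linear_combination (-(C (ρ a) * C G) * (1 + C (ρ a) * C G * X)) * h1 +
      (-(C (ρ a) * C G) * X ^ 2 * (PowerSeries.mk fun n => (ρ a * G) ^ n) - X) * h2
  rw [hS, map_add, map_mul, map_pow, map_one, map_natCast, PowerSeries.map_X, Finset.sum_mul,
    Finset.sum_congr rfl fun a _ => hterm a, Finset.sum_add_distrib, ← Finset.sum_mul,
    Finset.sum_neg_distrib, ← map_sum, sum_complexQuadraticChar hF, Finset.sum_const,
    Finset.card_univ, Fintype.card_units, hq, nsmul_eq_mul, Nat.cast_sub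
      (hq ▸ Fintype.card_pos)]
  simp
  ring

end ThreeModFour

end QuarticForm

/-! ### The theorem -/

open PowerSeries QuarticForm in
theorem theorem1p3 {F : Type*} [Field F] [Finite F] (p m q : ℕ) (hp : p.Prime) (hp2 : p ≠ 2)
    (hq : q = p ^ m) (hF : Nat.card F = q) (g : Fˣ) (hg : ∀ u : Fˣ, u ∈ Subgroup.zpowers g)
    (y : Fˣ) (hy : ¬ ∃ z : F, z ^ 4 = (y : F)) :
    (q % 4 = 1 →
      (∃! st : ℤ × ℤ, IsParam p m q g st.1 st.2) ∧
      ∀ s t : ℤ, IsParam p m q g s t →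
        (q % 8 = 1 →
          genFun F (y : F) =
            (q : ℚ⟦X⟧) * X * (1 - (q : ℚ⟦X⟧) * X)⁻¹ +
            ((q : ℚ⟦X⟧) - 1) * (3 * X ^ 2 + B₁ q s t (ind g y)) *
              (1 - 6 * (q : ℚ⟦X⟧) * X ^ 2 + 8 * (q : ℚ⟦X⟧) * (s : ℚ⟦X⟧) * X ^ 3 +
                ((q : ℚ⟦X⟧) ^ 2 - 4 * (q : ℚ⟦X⟧) * (s : ℚ⟦X⟧) ^ 2) * X ^ 4)⁻¹) ∧
        (q % 8 = 5 →
          genFun F (y : F) =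
            (q : ℚ⟦X⟧) * X * (1 - (q : ℚ⟦X⟧) * X)⁻¹ +
            ((q : ℚ⟦X⟧) - 1) * (-(X ^ 2) + B₂ q s t (ind g (-y))) *
              (1 + 2 * (q : ℚ⟦X⟧) * X ^ 2 + 8 * (q : ℚ⟦X⟧) * (s : ℚ⟦X⟧) * X ^ 3 +
                (9 * (q : ℚ⟦X⟧) ^ 2 - 4 * (q : ℚ⟦X⟧) * (s : ℚ⟦X⟧) ^ 2) * X ^ 4)⁻¹)) ∧
    (q % 4 = 3 →
      genFun F (y : F) =
        (q : ℚ⟦X⟧) * X * (1 - (q : ℚ⟦X⟧) * X)⁻¹ +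
        ((q : ℚ⟦X⟧) - 1) * X * (1 + (q : ℚ⟦X⟧) * X ^ 2)⁻¹) := by
  classical
  have := Fintype.ofFinite F
  rw [Nat.card_eq_fintype_card] at hF
  refine ⟨fun hq4 => ?_, fun hq4 => genFun_eq_of_card_mod_four (by rw [hF, hq4]) hF y hy⟩
  obtain ⟨k, hk⟩ : ∃ k, q = 4 * k + 1 := ⟨q / 4, by lia⟩
  have hkF : Fintype.card F = 4 * k + 1 := hF.trans hk
  have hpk : p ^ m = 4 * k + 1 := hq.symm.trans hk
  obtain ⟨χ, hχ⟩ := exists_gaussian_char hg hkF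
  obtain ⟨s₀, t₀, hst₀, hre, him⟩ := exists_isParam_jacobiSum hg hχ hp hkF hpk
  have huniq : ∀ s t : ℤ, IsParam p m q g s t → s = s₀ ∧ t = t₀ := fun s t h =>
    isParam_unique hp hkF hpk hp2 (by rwa [hk] at h) hst₀
  refine ⟨⟨(s₀, t₀), by rwa [hk], fun st h => Prod.ext (huniq _ _ h).1 (huniq _ _ h).2⟩, ?_⟩
  rintro s t hst
  obtain ⟨rfl, rfl⟩ := huniq s t hst
  have hc := gaussian_char_toComplex hχ
  have hJ : jacobiSum (χ.ringHomComp GaussianInt.toComplex) (χ.ringHomComp GaussianInt.toComplex) =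
      -s + 2 * t * Complex.I := by
    rw [jacobiSum_ringHomComp, GaussianInt.toComplex_def, hre, him]
    push_cast
    ring
  have hJ' : jacobiSum (χ.ringHomComp GaussianInt.toComplex)⁻¹
      (χ.ringHomComp GaussianInt.toComplex)⁻¹ = -s - 2 * t * Complex.I := by
    rw [jacobiSum_inv_toComplex, GaussianInt.toComplex_def, Zsqrtd.re_star, Zsqrtd.im_star, hre, him]
    push_cast
    ring
  set φ := χ.ringHomComp GaussianInt.toComplex
  have hφy : φ y ≠ 1 := by
    rw [Ne, char_eq_one_iff hg hc]
    rintro ⟨z, rfl⟩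
    exact hy ⟨z, by simp⟩
  have hnorm : (q : ℚ) = s ^ 2 + 4 * t ^ 2 := by
    have := norm_jacobiSum hχ hkF
    rw [hre, him, ← hk] at this
    have h2 : (q : ℤ) = s ^ 2 + 4 * t ^ 2 := by rw [← this]; ring
    exact_mod_cast h2
  have hnormX : (q : ℚ⟦X⟧) = (s : ℚ⟦X⟧) ^ 2 + 4 * (t : ℚ⟦X⟧) ^ 2 := by
    have := congrArg (C (R := ℚ)) hnorm
    simpa [map_ofNat (C (R := ℚ))] using this
  refine ⟨fun hq8 => ?_, fun hq8 => ?_⟩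
  · have hε : (-1 : ℚ) ^ k = 1 := Even.neg_one_pow (Nat.even_iff.2 (by lia))
    refine genFun_eq_of_jacobiSum hg hc hkF hJ hJ' y hk ?_ ?_
    · rw [hε]
      rcases ind_cases hg hc y with ⟨hi, h⟩ | ⟨hi, h⟩ | ⟨hi, h⟩ | ⟨hi, h⟩
      · exact absurd h hφy
      · refine Or.inl ⟨h, ?_⟩
        simp only [B₁, hi]
        norm_num [map_ofNat (C (R := ℚ))]
        ring
      · refine Or.inr (Or.inl ⟨h, ?_⟩)
        simp only [B₁, hi]
        norm_num [map_ofNat (C (R := ℚ))]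
        -- The cubic coefficients agree through q = s² + 4t²: 3q − 4s² = −q + 16t².
        linear_combination (-4 * X ^ 3) * hnormX
      · refine Or.inr (Or.inr ⟨h, ?_⟩)
        simp only [B₁, hi]
        norm_num [map_ofNat (C (R := ℚ))]
        ring
    · rw [hε]
      norm_num [map_ofNat (C (R := ℚ))]
      ring
  · have hε : (-1 : ℚ) ^ k = -1 := Odd.neg_one_pow (Nat.odd_iff.2 (by lia))
    -- Here k is odd, so χ(−1) = −1 and passing to −y shifts the index by 2 modulo 4; the excluded
    -- class of y is index 2 for −y.
    have hneg : φ ((-y : Fˣ) : F) = -φ y := by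
      rw [Units.val_neg, neg_eq_neg_one_mul, map_mul, char_neg_one hg hc hkF,
        Odd.neg_one_pow (Nat.odd_iff.2 (by lia)), neg_one_mul]
    refine genFun_eq_of_jacobiSum hg hc hkF hJ hJ' y hk ?_ ?_
    · rw [hε]
      rcases ind_cases hg hc (-y) with ⟨hi, h⟩ | ⟨hi, h⟩ | ⟨hi, h⟩ | ⟨hi, h⟩ <;>
        rw [hneg, neg_eq_iff_eq_neg] at h
      · refine Or.inr (Or.inl ⟨h, ?_⟩)
        simp only [B₂, hi]
        norm_num [map_ofNat (C (R := ℚ))]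
        ring
      · refine Or.inr (Or.inr ⟨h, ?_⟩)
        simp only [B₂, hi]
        norm_num [map_ofNat (C (R := ℚ))]
        ring
      · exact absurd (h.trans (neg_neg 1)) hφy
      · refine Or.inl ⟨h.trans (neg_neg _), ?_⟩
        simp only [B₂, hi]
        norm_num [map_ofNat (C (R := ℚ))]
        ring
    · rw [hε]
      norm_num [map_ofNat (C (R := ℚ))]
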